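/- Let $\Sigma$ be a finite union of disjoint oriented circles in $\mathbb{C}$ bounding a domain $\Omega_+$ to its left, let $\Omega_-=\mathbb{C}\setminus(\Omega_+\cup\Sigma)$, and let $G:\Sigma\to \mathrm{GL}(2,\mathbb{C})$ be a jump matrix. The associated homogeneous Riemann--Hilbert problem (RHP) asks for the holomorphic functions $\Psi:\mathbb{C}\setminus\Sigma\to\mathbb{C}^{2\times 2}$, extending continuously to $\Sigma$ from $\Omega_+$ and from $\Omega_-$ with boundary values $\Psi_+$ and $\Psi_-$, such that $$\Psi_+(\zeta)=G(\zeta)^{-1}\,\Psi_-(\zeta)\quad(\zeta\in\Sigma),\qquad \Psi(z)=O(z^{-1})\quad(z\to\infty).$$ The Fredholm equation (for the boundary values $\Phi_-$ of the RHP $\Phi_+=G\Phi_-$, $\Phi(z)=I+O(z^{-1})$) is the second-kind integral equation in $L^2(\Sigma,\mathbb{C}^{2\times2})$ $$\Phi_-(\zeta)-\frac1{2\pi i}\int_\Sigma\frac{G(\zeta)^{-1}G(\eta)-I}{\eta-\zeta}\,\Phi_-(\eta)\,d\eta=I\qquad(\zeta\in\Sigma).$$ The nullity of either problem is the complex dimension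 of the space of solutions of the homogeneous problem (for the Fredholm equation: with right-hand side $0$ instead of $I$). (i) (Discrete map $Z^a$.) Let $0<a<2$, let $n,m\ge 0$ be integers with $n+m$ even, and let $0<r_1,r_2<1$ and $R>1+\max(r_1,r_2)$. Let $\Sigma$ consist of the counterclockwise circle $|\zeta|=R$ and the clockwise circles $|\zeta-1|=r_1$, $|\zeta+1|=r_2$. Let $$G(\zeta)=\begin{pmatrix}\zeta^{(m+n)/2}&0\\0&\zeta^{-(m+n)/2}\end{pmatrix}\ (|\zeta|=R),\qquad G(\zeta)=\begin{pmatrix}1&0\\ e^{ia\pi/2}\zeta^{-a/2}(\zeta-1)^{-m}(\zeta+1)^{-n}&1\end{pmatrix}^{-1}$$ on the two small circles, where $e^{ia\pi/2}\zeta^{-a/2}=e^{ia\pi/4}e^{-\frac a2\operatorname{Log}(\zeta/i)}$ with the principal branch $\operatorname{Log}$. Then the associated homogeneous RHP and the Fredholm equation both have nullity $n+m$. (ii) (Model problem.) Let $m\ge 0$ be an integer, let $\Sigma$ be the counterclockwise unit circle and $$G(\zeta)=\begin{pmatrix}\zeta^m&0\\ e^\zeta&\zeta^{-m}\end{pmatrix}.$$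 Then the associated homogeneous RHP and the Fredholm equation both have nullity $2m$. -/

import Mathlib

open MeasureTheory Filter Topology

noncomputable section

/-- A system of `N` oriented circles in the complex plane; `orient i = 1` means that the `i`-th
circle is traversed counterclockwise, `orient i = -1` that it is traversed clockwise. -/
structure CircleSystem (N : ℕ) where
  center : Fin N → ℂ
  radius : Fin N → ℝ
  radius_pos : ∀ i, 0 < radius i
  orient : Fin N → ℤˣ

namespace CircleSystem

variable {N : ℕ} (S : CircleSystem N)

/-- The point set `Σ` of the contour. -/
def support : Set ℂ := ⋃ i, Metric.sphere (S.center i) (S.radius i)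

/-- The winding number of the contour about a point `z` off the contour. -/
def winding (z : ℂ) : ℤ :=
  ∑ i, (Metric.ball (S.center i) (S.radius i)).indicator (fun _ => (S.orient i : ℤ)) z

/-- The region `Ω₊` to the left of the contour: the points of winding number one. -/
def plusRegion : Set ℂ := {z | z ∉ S.support ∧ S.winding z = 1}

/-- The region `Ω₋`: the complement of `Ω₊ ∪ Σ`. -/
def minusRegion : Set ℂ := (S.plusRegion ∪ S.support)ᶜ

/-- Arc length measure on the contour. -/
def arcLength : Measure ℂ :=
  ∑ i, ENNReal.ofReal (S.radius i) •
    (volume.restrict (Set.Ioc 0 (2 * Real.pi))).map (circleMap (S.center i) (S.radius i))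

/-- Integrability of a function along every circle of the contour. -/
def ContourIntegrable (f : ℂ → ℂ) : Prop :=
  ∀ i, CircleIntegrable f (S.center i) (S.radius i)

/-- The oriented contour integral `∫_Σ f(η) dη`. -/
def contourIntegral (f : ℂ → ℂ) : ℂ :=
  ∑ i, ((S.orient i : ℤ) : ℂ) * ∮ z in C(S.center i, S.radius i), f z

/-- The space `L²(Σ, ℂ^{2×2})`: the `2×2` matrices of (classes of) functions in `L²(Σ)`. -/
abbrev L2Matrix : Type := Matrix (Fin 2) (Fin 2) (Lp ℂ 2 S.arcLength)

variable {S} in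
/-- The value at `ζ` of (a representative of) a matrix-valued `L²` function. -/
def L2Matrix.eval (u : S.L2Matrix) (ζ : ℂ) : Matrix (Fin 2) (Fin 2) ℂ :=
  Matrix.of fun i j => (u i j : ℂ → ℂ) ζ

theorem contourIntegral_add {f g : ℂ → ℂ} (hf : S.ContourIntegrable f)
    (hg : S.ContourIntegrable g) :
    S.contourIntegral (f + g) = S.contourIntegral f + S.contourIntegral g := by
  simp only [contourIntegral, ← Finset.sum_add_distrib]
  refine Finset.sum_congr rfl fun i _ => ?_
  rw [← mul_add]
  congr 1
  simpa using circleIntegral.integral_add (hf i) (hg i)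

theorem contourIntegral_smul (c : ℂ) (f : ℂ → ℂ) :
    S.contourIntegral (c • f) = c * S.contourIntegral f := by
  simp only [contourIntegral, Finset.mul_sum]
  refine Finset.sum_congr rfl fun i _ => ?_
  have h := circleIntegral.integral_smul c f (S.center i) (S.radius i)
  simp only [smul_eq_mul] at h
  simp only [Pi.smul_apply, smul_eq_mul, h]
  ring

/-- Equality almost everywhere for arc length is equality at almost all parameters. -/
theorem ae_circleMap {p : ℂ → Prop} (h : ∀ᵐ ζ ∂S.arcLength, p ζ) (i : Fin N) :
    ∀ᵐ θ ∂(volume.restrict (Set.Ioc 0 (2 * Real.pi))),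
      p (circleMap (S.center i) (S.radius i) θ) := by
  have hle : ENNReal.ofReal (S.radius i) •
      (volume.restrict (Set.Ioc 0 (2 * Real.pi))).map (circleMap (S.center i) (S.radius i))
        ≤ S.arcLength :=
    Finset.single_le_sum (f := fun i => ENNReal.ofReal (S.radius i) •
      (volume.restrict (Set.Ioc 0 (2 * Real.pi))).map (circleMap (S.center i) (S.radius i)))
      (fun _ _ => Measure.zero_le _) (Finset.mem_univ i)
  have h1 := ae_mono hle h
  rw [Measure.ae_ennreal_smul_measure_eq (by simpa using S.radius_pos i)] at h1
  exact ae_of_ae_map (measurable_circleMap _ _).aemeasurable h1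

theorem contourIntegrable_congr {f g : ℂ → ℂ} (h : ∀ᵐ ζ ∂S.arcLength, f ζ = g ζ)
    (hf : S.ContourIntegrable f) : S.ContourIntegrable g := by
  intro i
  refine (hf i).congr_ae ?_
  rw [Set.uIoc_of_le Real.two_pi_pos.le]
  exact S.ae_circleMap h i

theorem contourIntegral_congr {f g : ℂ → ℂ} (h : ∀ᵐ ζ ∂S.arcLength, f ζ = g ζ) :
    S.contourIntegral f = S.contourIntegral g := by
  simp only [contourIntegral]
  refine Finset.sum_congr rfl fun i _ => ?_
  congr 1
  simp only [circleIntegral]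
  refine intervalIntegral.integral_congr_ae ?_
  rw [Set.uIoc_of_le Real.two_pi_pos.le]
  rw [← ae_restrict_iff' measurableSet_Ioc]
  filter_upwards [S.ae_circleMap h i] with θ hθ
  rw [hθ]

/-- The homogeneous Riemann--Hilbert problem associated with the jump matrix `G`: the space of all
`Ψ`, holomorphic on `ℂ ∖ Σ`, which have limits `Ψ₊(ζ)`, `Ψ₋(ζ)` from `Ω₊`, `Ω₋` at every `ζ ∈ Σ`
(so that they extend continuously to `Σ` from either side), with `Ψ₊ = G⁻¹ Ψ₋` on `Σ` and
`Ψ(z) = O(z⁻¹)` as `z → ∞`. A function on `ℂ ∖ Σ` is represented by its extension by zero. -/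
def associatedRHP (G : ℂ → Matrix (Fin 2) (Fin 2) ℂ) :
    Submodule ℂ (ℂ → Matrix (Fin 2) (Fin 2) ℂ) where
  carrier := {Ψ |
    (∀ z ∈ S.support, Ψ z = 0) ∧
    (∀ i j, DifferentiableOn ℂ (fun z => Ψ z i j) S.supportᶜ) ∧
    (∀ ζ ∈ S.support, ∃ Ψplus Ψminus : Matrix (Fin 2) (Fin 2) ℂ,
      Tendsto Ψ (𝓝[S.plusRegion] ζ) (𝓝 Ψplus) ∧
      Tendsto Ψ (𝓝[S.minusRegion] ζ) (𝓝 Ψminus) ∧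
      Ψplus = (G ζ)⁻¹ * Ψminus) ∧
    (∀ i j, (fun z => Ψ z i j) =O[Bornology.cobounded ℂ] fun z : ℂ => z⁻¹)}
  zero_mem' := by
    refine ⟨fun _ _ => rfl, fun i j => differentiableOn_const (0 : ℂ), fun ζ _ =>
      ⟨0, 0, tendsto_const_nhds, tendsto_const_nhds, by simp⟩, fun i j => ?_⟩
    exact Asymptotics.isBigO_zero _ _
  add_mem' := by
    rintro Ψ Χ ⟨h1, h2, h3, h4⟩ ⟨k1, k2, k3, k4⟩
    refine ⟨fun z hz => by simp [h1 z hz, k1 z hz], fun i j => (h2 i j).add (k2 i j),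
      fun ζ hζ => ?_, fun i j => (h4 i j).add (k4 i j)⟩
    obtain ⟨P, M, hP, hM, h⟩ := h3 ζ hζ
    obtain ⟨P', M', hP', hM', h'⟩ := k3 ζ hζ
    exact ⟨P + P', M + M', hP.add hP', hM.add hM', by rw [h, h', mul_add]⟩
  smul_mem' := by
    rintro c Ψ ⟨h1, h2, h3, h4⟩
    refine ⟨fun z hz => by simp [h1 z hz], fun i j => (h2 i j).const_smul c,
      fun ζ hζ => ?_, fun i j => (h4 i j).const_smul_left c⟩
    obtain ⟨P, M, hP, hM, h⟩ := h3 ζ hζ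
    exact ⟨c • P, c • M, hP.const_smul c, hM.const_smul c, by rw [h, Matrix.mul_smul]⟩

/-- The kernel `(G(ζ)⁻¹ G(η) - I) / (η - ζ)`. (It is only used under an integral in `η` for fixed
`ζ`, so that its value on the diagonal is immaterial.) -/
def fredholmKernel (G : ℂ → Matrix (Fin 2) (Fin 2) ℂ) (ζ η : ℂ) : Matrix (Fin 2) (Fin 2) ℂ :=
  (η - ζ)⁻¹ • ((G ζ)⁻¹ * G η - 1)

theorem integrand_add (G : ℂ → Matrix (Fin 2) (Fin 2) ℂ) (u v : S.L2Matrix) (ζ : ℂ) (i j : Fin 2) :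
    ∀ᵐ η ∂S.arcLength, ((fun η => (fredholmKernel G ζ η * u.eval η) i j) +
      fun η => (fredholmKernel G ζ η * v.eval η) i j) η =
        (fredholmKernel G ζ η * L2Matrix.eval (u + v) η) i j := by
  filter_upwards [Lp.coeFn_add (u 0 j) (v 0 j), Lp.coeFn_add (u 1 j) (v 1 j)] with η h0 h1
  simp only [Pi.add_apply, Matrix.mul_apply, Fin.sum_univ_two, L2Matrix.eval, Matrix.of_apply,
    Matrix.add_apply, h0, h1]
  ring

theorem integrand_smul (G : ℂ → Matrix (Fin 2) (Fin 2) ℂ) (c : ℂ) (u : S.L2Matrix) (ζ : ℂ)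
    (i j : Fin 2) :
    ∀ᵐ η ∂S.arcLength, (c • fun η => (fredholmKernel G ζ η * u.eval η) i j) η =
      (fredholmKernel G ζ η * L2Matrix.eval (c • u) η) i j := by
  filter_upwards [Lp.coeFn_smul c (u 0 j), Lp.coeFn_smul c (u 1 j)] with η h0 h1
  simp only [Pi.smul_apply, Matrix.mul_apply, Fin.sum_univ_two, L2Matrix.eval, Matrix.of_apply,
    Matrix.smul_apply, h0, h1, smul_eq_mul]
  ring

/-- The null space of the integral equation: all `u ∈ L²(Σ, ℂ^{2×2})` such that
`u(ζ) - (2πi)⁻¹ ∫_Σ (G(ζ)⁻¹ G(η) - I) / (η - ζ) u(η) dη = 0` for almost all `ζ ∈ Σ`.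
(The integrals exist automatically if the kernel is bounded.) -/
def fredholmNullSpace (G : ℂ → Matrix (Fin 2) (Fin 2) ℂ) : Submodule ℂ S.L2Matrix where
  carrier := {u | ∀ᵐ ζ ∂S.arcLength, ∀ i j,
    S.ContourIntegrable (fun η => (fredholmKernel G ζ η * u.eval η) i j) ∧
    u.eval ζ i j - (2 * Real.pi * Complex.I)⁻¹ *
      S.contourIntegral (fun η => (fredholmKernel G ζ η * u.eval η) i j) = 0}
  add_mem' := by
    intro u v hu hv
    have hE : ∀ᵐ ζ ∂S.arcLength, ∀ i j,
        L2Matrix.eval (u + v) ζ i j = u.eval ζ i j + v.eval ζ i j := by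
      rw [ae_all_iff]; intro i
      rw [ae_all_iff]; intro j
      exact Lp.coeFn_add (u i j) (v i j)
    filter_upwards [hu, hv, hE] with ζ h k e i j
    obtain ⟨h1, h2⟩ := h i j
    obtain ⟨k1, k2⟩ := k i j
    have hc := S.integrand_add G u v ζ i j
    refine ⟨S.contourIntegrable_congr hc fun l => (h1 l).add (k1 l), ?_⟩
    rw [← S.contourIntegral_congr hc, S.contourIntegral_add h1 k1, e i j]
    linear_combination h2 + k2
  zero_mem' := by
    have hz : ∀ᵐ ζ ∂S.arcLength, ((0 : Lp ℂ 2 S.arcLength) : ℂ → ℂ) ζ = 0 :=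
      Lp.coeFn_zero ℂ 2 S.arcLength
    have he : ∀ᵐ ζ ∂S.arcLength, L2Matrix.eval (0 : S.L2Matrix) ζ = 0 := by
      filter_upwards [hz] with ζ h
      ext i j
      exact h
    filter_upwards [he] with ζ h i j
    have hc : ∀ᵐ η ∂S.arcLength,
        (0 : ℂ → ℂ) η = (fredholmKernel G ζ η * L2Matrix.eval (0 : S.L2Matrix) η) i j := by
      filter_upwards [he] with η h
      simp [h]
    have h0 : S.ContourIntegrable 0 := fun l => circleIntegrable_const 0 _ _
    refine ⟨S.contourIntegrable_congr hc h0, ?_⟩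
    rw [← S.contourIntegral_congr hc, h]
    simp [contourIntegral, circleIntegral]
  smul_mem' := by
    intro c u hu
    have hE : ∀ᵐ ζ ∂S.arcLength, ∀ i j,
        L2Matrix.eval (c • u) ζ i j = c * u.eval ζ i j := by
      rw [ae_all_iff]; intro i
      rw [ae_all_iff]; intro j
      exact Lp.coeFn_smul c (u i j)
    filter_upwards [hu, hE] with ζ h e i j
    obtain ⟨h1, h2⟩ := h i j
    have hc := S.integrand_smul G c u ζ i j
    refine ⟨S.contourIntegrable_congr hc fun l => (h1 l).const_smul, ?_⟩
    rw [← S.contourIntegral_congr hc, S.contourIntegral_smul, e i j]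
    linear_combination c * h2

end CircleSystem

/-- The contour of the Riemann--Hilbert problem of the discrete map `Z^a`: a counterclockwise circle
of radius `R` about `0` and clockwise circles of radii `r₁`, `r₂` about `1` and `-1`. -/
def zaContour (r₁ r₂ R : ℝ) (h₁ : 0 < r₁) (h₂ : 0 < r₂) (hR : 0 < R) : CircleSystem 3 where
  center := ![0, 1, -1]
  radius := ![R, r₁, r₂]
  radius_pos := by intro i; fin_cases i <;> assumption
  orient := ![1, -1, -1]

/-- The jump matrix `G₁` on the small circles, oriented counterclockwise; the entry
`e^{iaπ/2} ζ^{-a/2}` is taken with the branch cut of the power at the negative imaginary axis. -/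
def zaG₁ (a : ℝ) (n m : ℕ) (ζ : ℂ) : Matrix (Fin 2) (Fin 2) ℂ :=
  !![1, 0;
     Complex.exp (Complex.I * a * Real.pi / 4) *
       Complex.exp (-(a / 2) * Complex.log (ζ / Complex.I)) *
         ((ζ - 1) ^ m)⁻¹ * ((ζ + 1) ^ n)⁻¹, 1]

/-- The jump matrix `G₂` on the large circle (used for `n + m` even). -/
def zaG₂ (n m : ℕ) (ζ : ℂ) : Matrix (Fin 2) (Fin 2) ℂ :=
  !![ζ ^ ((m + n) / 2), 0;
     0, (ζ ^ ((m + n) / 2))⁻¹]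

open Classical in
/-- The jump matrix on `zaContour`: `G₂` on the large circle and, because the small circles are
clockwise there, `G₁⁻¹` on the small circles. -/
def zaJump (a : ℝ) (n m : ℕ) (R : ℝ) (ζ : ℂ) : Matrix (Fin 2) (Fin 2) ℂ :=
  if ‖ζ‖ = R then zaG₂ n m ζ else (zaG₁ a n m ζ)⁻¹

/-- The contour of the model problem: the counterclockwise unit circle. -/
def modelContour : CircleSystem 1 where
  center := fun _ => 0
  radius := fun _ => 1
  radius_pos := fun _ => one_pos
  orient := fun _ => 1

/-- The jump matrix of the model problem. -/
def modelJump (m : ℕ) (ζ : ℂ) : Matrix (Fin 2) (Fin 2) ℂ :=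
  !![ζ ^ m, 0;
     Complex.exp ζ, (ζ ^ m)⁻¹]

end

/-! Both problems share one shape: on every circle the jump is lower triangular with entry `b`, with
diagonal `(ζ ^ k, ζ ^ (-k))` on the outer circle and `(1, 1)` on the inner ones. Here `2 * k` is `n
+ m` or `2 * m`. Columns do not interact, so each nullity is twice that of one column, and the claim
is that a column has nullity `k` whatever `b` is.

For the Riemann–Hilbert problem, the first row satisfies `Ψ₊ = ζ ^ (-k) Ψ₋` on the outer circle and
is continuous across the inner ones. Hence `z ^ k Ψ` inside and `Ψ` outside glue to an entire
function that is `O(z⁻¹)`, so the first row vanishes. Then `b` drops out of the second row: `Ψ`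
inside and `z ^ k Ψ` outside glue to an entire function that is `O(z ^ (k - 1))`, that is, a
polynomial of degree less than `k`, and each such polynomial occurs. The gluing (`exists_entire`)
rests on circles being removable for continuous functions; `range_rhpSolution` concludes.

For the integral equation, the first row decouples and is a fixed point of `diagOp` with exponent
`k`; the second has exponent `-k` and a source term built from the first. On the outer circle, the
part of the kernel coming from that circle is a geometric sum, so it yields only a polynomial of
degree less than `k` with moments as coefficients. On the inner circles the solution (up to the
source) is the Cauchy integral of outer data, hence holomorphic in the disc, and its integrals over
the holes vanish. The fixed points for exponent `k` are exactly `ζ ^ (-k) p` on the outer circle and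
`p` on the inner ones, with `p` of degree less than `k` (`eq_of_diagOp_pos`,
`diagOp_pos_outerPow_mul_eval`). For exponent `-k` the polynomial part is minus a projection, so the
identity minus `diagOp` is injective (`eq_zero_of_diagOp_neg`) and solvable for bounded measurable
sources (`exists_diagOp_neg`). The first row is therefore free in a `k`-dimensional space per column
and determines the second (`rank_fredholmNullSpace`). -/

noncomputable section

/-! ### Removability of circles and Liouville's theorem -/

/-- The Cauchy integral of a continuous function on a circle is holomorphic off the circle. -/
theorem differentiableAt_cauchyIntegral {c : ℂ} {r : ℝ} (hr : 0 ≤ r) {f : ℂ → ℂ}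
    (hf : ContinuousOn f (Metric.sphere c r)) {z : ℂ} (hz : z ∉ Metric.sphere c r) :
    DifferentiableAt ℂ (fun z => ∮ w in C(c, r), (w - z)⁻¹ * f w) z := by
  obtain ⟨ε, hε, hball⟩ := Metric.isOpen_iff.1
    (Metric.isClosed_sphere (x := c) (ε := r)).isOpen_compl z hz
  have hfc : Continuous fun θ => f (circleMap c r θ) :=
    hf.comp_continuous (continuous_circleMap c r) fun θ => circleMap_mem_sphere c hr θ
  have hdc : Continuous fun θ => deriv (circleMap c r) θ := by
    simp only [deriv_circleMap]; fun_prop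
  have hsub : ∀ x ∈ Metric.ball z (ε / 2), ∀ θ, ε / 2 ≤ ‖circleMap c r θ - x‖ := by
    intro x hx θ
    by_contra! h
    refine hball (a := circleMap c r θ) ?_ (circleMap_mem_sphere c hr θ)
    rw [Metric.mem_ball] at hx ⊢
    calc dist (circleMap c r θ) z ≤ dist (circleMap c r θ) x + dist x z := dist_triangle _ _ _
      _ < ε := by rw [dist_eq_norm (circleMap c r θ)]; linarith
  have hne : ∀ x ∈ Metric.ball z (ε / 2), ∀ θ, circleMap c r θ - x ≠ 0 := fun x hx θ h => by
    have := hsub x hx θ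
    rw [h, norm_zero] at this
    linarith
  have hc1 : ∀ x ∈ Metric.ball z (ε / 2),
      Continuous fun θ => deriv (circleMap c r) θ • ((circleMap c r θ - x)⁻¹ * f (circleMap c r θ)) :=
    fun x hx => hdc.smul ((((continuous_circleMap c r).sub continuous_const).inv₀
      (hne x hx)).mul hfc)
  have hc2 : ∀ x ∈ Metric.ball z (ε / 2), Continuous fun θ => deriv (circleMap c r) θ •
      (((circleMap c r θ - x) ^ 2)⁻¹ * f (circleMap c r θ)) :=
    fun x hx => hdc.smul (((((continuous_circleMap c r).sub continuous_const).pow 2).inv₀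
      fun θ => pow_ne_zero 2 (hne x hx θ)).mul hfc)
  have hz0 : z ∈ Metric.ball z (ε / 2) := Metric.mem_ball_self (by linarith)
  have key := intervalIntegral.hasDerivAt_integral_of_dominated_loc_of_deriv_le (𝕜 := ℂ)
    (μ := volume) (a := 0) (b := 2 * Real.pi)
    (F := fun x θ => deriv (circleMap c r) θ • ((circleMap c r θ - x)⁻¹ * f (circleMap c r θ)))
    (F' := fun x θ => deriv (circleMap c r) θ •
      (((circleMap c r θ - x) ^ 2)⁻¹ * f (circleMap c r θ)))
    (x₀ := z) (s := Metric.ball z (ε / 2))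
    (bound := fun θ => ‖deriv (circleMap c r) θ‖ * (((ε / 2) ^ 2)⁻¹ * ‖f (circleMap c r θ)‖))
    (Metric.isOpen_ball.mem_nhds hz0)
    (eventually_of_mem (Metric.isOpen_ball.mem_nhds hz0) fun x hx =>
      (hc1 x hx).aestronglyMeasurable)
    ((hc1 z hz0).intervalIntegrable _ _) (hc2 z hz0).aestronglyMeasurable
    (Eventually.of_forall fun θ _ x hx => by
      rw [norm_smul, norm_mul, norm_inv, norm_pow]
      have := hsub x hx θ
      gcongr)
    ((hdc.norm.mul (continuous_const.mul hfc.norm)).intervalIntegrable _ _)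
    (Eventually.of_forall fun θ _ x hx => by
      have h1 : HasDerivAt (fun x => circleMap c r θ - x) (-1) x := by
        simpa using (hasDerivAt_id x).const_sub (circleMap c r θ)
      have h2 := ((h1.fun_inv (hne x hx θ)).mul_const (f (circleMap c r θ))).const_mul
        (deriv (circleMap c r) θ)
      simpa only [neg_neg, one_div, smul_eq_mul] using h2)
  exact key.2.differentiableAt

/-- **Cauchy's integral formula** for an annulus. -/
theorem cauchyFormula_annulus {c : ℂ} {r R : ℝ} (h0 : 0 < r) (hle : r ≤ R) {f : ℂ → ℂ}
    (hc : ContinuousOn f (Metric.closedBall c R \ Metric.ball c r))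
    (hd : ∀ z ∈ Metric.ball c R \ Metric.closedBall c r, DifferentiableAt ℂ f z) {z : ℂ}
    (hz : z ∈ Metric.ball c R \ Metric.closedBall c r) :
    (∮ w in C(c, R), (w - z)⁻¹ * f w) - (∮ w in C(c, r), (w - z)⁻¹ * f w) =
      2 * Real.pi * Complex.I * f z := by
  have hR : 0 < R := h0.trans_le hle
  have hnhds : Metric.closedBall c R \ Metric.ball c r ∈ 𝓝 z :=
    mem_of_superset ((Metric.isOpen_ball.sdiff Metric.isClosed_closedBall).mem_nhds hz)
      (Set.sdiff_subset_sdiff Metric.ball_subset_closedBall Metric.ball_subset_closedBall)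
  -- Cauchy's theorem is applied to the divided difference of `f` at `z`. The formula follows
  -- because `(w - z)⁻¹` integrates to `2πi` over the outer circle and to `0` over the inner one.
  have hg := Complex.circleIntegral_eq_of_differentiable_on_annulus_off_countable h0 hle
    (f := dslope f z) (Set.countable_singleton z) ((continuousOn_dslope hnhds).2 ⟨hc, hd z hz⟩)
    fun w hw => (differentiableAt_dslope_of_ne hw.2).2 (hd w hw.1)
  have hsR : Metric.sphere c R ⊆ Metric.closedBall c R \ Metric.ball c r := fun w hw => by
    have : dist w c = R := hw
    exact ⟨this.le, fun h => absurd (Metric.mem_ball.1 h) (by linarith)⟩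
  have hsr : Metric.sphere c r ⊆ Metric.closedBall c R \ Metric.ball c r := fun w hw => by
    have : dist w c = r := hw
    exact ⟨Metric.mem_closedBall.2 (by linarith), fun h => absurd (Metric.mem_ball.1 h) (by linarith)⟩
  have hneR : ∀ w ∈ Metric.sphere c R, w ≠ z := fun w hw h => by
    have h1 : dist w c = R := hw
    have h2 := Metric.mem_ball.1 hz.1
    rw [h] at h1; linarith
  have hner : ∀ w ∈ Metric.sphere c r, w ≠ z := fun w hw h => by
    have h1 : dist w c = r := hw
    exact hz.2 (by rw [← h]; exact h1.le)
  have split : ∀ ρ, 0 < ρ → (∀ w ∈ Metric.sphere c ρ, w ≠ z) →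
      Metric.sphere c ρ ⊆ Metric.closedBall c R \ Metric.ball c r →
      (∮ w in C(c, ρ), dslope f z w) =
        (∮ w in C(c, ρ), (w - z)⁻¹ * f w) - (∮ w in C(c, ρ), (w - z)⁻¹) * f z := by
    intro ρ hρ hne hs
    have hc' : ContinuousOn (fun w => (w - z)⁻¹) (Metric.sphere c ρ) :=
      (continuousOn_id.sub continuousOn_const).inv₀ fun w hw => sub_ne_zero.2 <| hne w hw
    have := circleIntegral.integral_smul_const (fun w => (w - z)⁻¹) (f z) c ρ
    simp only [smul_eq_mul] at this
    rw [← this, ← circleIntegral.integral_sub]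
    · refine circleIntegral.integral_congr hρ.le fun w hw => ?_
      simp only [dslope_of_ne _ (hne w hw), slope_def_field]
      ring
    · exact (hc'.mul (hc.mono hs)).circleIntegrable hρ.le
    · exact (hc'.mul continuousOn_const).circleIntegrable hρ.le
  rw [split R hR hneR hsR, split r h0 hner hsr, circleIntegral.integral_sub_inv_of_mem_ball hz.1,
    Complex.circleIntegral_eq_zero_of_differentiable_on_off_countable h0.le Set.countable_empty
      (f := fun w => (w - z)⁻¹)] at hg
  · linear_combination hg
  · exact (continuousOn_id.sub continuousOn_const).inv₀ fun w hw => sub_ne_zero.2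
      fun h => hz.2 (by rw [← show w = z from h]; exact hw)
  · intro w hw
    refine (differentiableAt_id.sub_const z).inv (sub_ne_zero.2 fun h => hz.2 ?_)
    rw [← h]; exact Metric.ball_subset_closedBall hw.1

/-- A circle is removable for continuous functions that are holomorphic off the circle. -/
theorem differentiableOn_of_off_sphere {c : ℂ} {r : ℝ} (hr : 0 < r) {U : Set ℂ} (hU : IsOpen U)
    (hsU : Metric.sphere c r ⊆ U) {f : ℂ → ℂ} (hc : ContinuousOn f U)
    (hd : DifferentiableOn ℂ f (U \ Metric.sphere c r)) : DifferentiableOn ℂ f U := by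
  have hdat : ∀ z ∈ U, dist z c ≠ r → DifferentiableAt ℂ f z := fun z hz hzr =>
    (hd z ⟨hz, hzr⟩).differentiableAt ((hU.sdiff Metric.isClosed_sphere).mem_nhds ⟨hz, hzr⟩)
  intro z₀ hz₀
  by_cases hz₀r : dist z₀ c = r
  swap
  · exact (hdat z₀ hz₀ hz₀r).differentiableWithinAt
  obtain ⟨δ, hδ, hthick⟩ := (isCompact_sphere c r).exists_cthickening_subset_open hU hsU
  obtain ⟨ε, hε, hεr, hεδ⟩ : ∃ ε, 0 < ε ∧ ε < r ∧ ε ≤ δ :=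
    ⟨min δ (r / 2), by positivity, (min_le_right _ _).trans_lt (by linarith), min_le_left _ _⟩
  have hann : ∀ z, r - ε ≤ dist z c → dist z c ≤ r + ε → z ∈ U := by
    intro z h1 h2
    have hzc : 0 < dist z c := by linarith
    apply hthick
    -- The point `c + t * (z - c)` is the radial projection of `z` to the circle; it witnesses that
    -- the annulus of half-width `ε` lies in the thickening.
    set t : ℂ := ((r / dist z c : ℝ) : ℂ)
    refine Metric.mem_cthickening_of_dist_le z (c + t * (z - c)) δ _ ?_ ?_
    · rw [mem_sphere_iff_norm, add_sub_cancel_left, norm_mul, Complex.norm_real, ← dist_eq_norm,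
        Real.norm_of_nonneg (by positivity)]
      field_simp
    · have : z - (c + t * (z - c)) = ((1 - r / dist z c : ℝ) : ℂ) * (z - c) := by
        simp only [t]; push_cast; ring
      rw [dist_eq_norm, this, norm_mul, Complex.norm_real, ← dist_eq_norm z c, Real.norm_eq_abs,
        ← abs_of_nonneg (dist_nonneg (x := z) (y := c)), ← abs_mul, abs_of_pos hzc]
      have : (1 - r / dist z c) * dist z c = dist z c - r := by field_simp
      rw [this, abs_le]
      constructor <;> linarith
  have hsph : ∀ ρ, r - ε ≤ ρ → ρ ≤ r + ε → ContinuousOn f (Metric.sphere c ρ) :=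
    fun ρ h1 h2 => hc.mono fun z hz => by
      have : dist z c = ρ := hz
      exact hann z (by linarith) (by linarith)
  have hcont : ∀ a b, r - ε ≤ a → b ≤ r + ε →
      ContinuousOn f (Metric.closedBall c b \ Metric.ball c a) := fun a b ha hb =>
    hc.mono fun z hz => by
      have h1 := Metric.mem_closedBall.1 hz.1
      have h2 := not_lt.1 (mt Metric.mem_ball.2 hz.2)
      exact hann z (by linarith) (by linarith)
  have hdiff1 : ∀ z ∈ Metric.ball c (r + ε) \ Metric.closedBall c r, DifferentiableAt ℂ f z := by
    intro z hz
    have h1 := Metric.mem_ball.1 hz.1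
    have h2 := not_le.1 (mt Metric.mem_closedBall.2 hz.2)
    exact hdat z (hann z (by linarith) (by linarith)) h2.ne'
  have hdiff2 : ∀ z ∈ Metric.ball c r \ Metric.closedBall c (r - ε), DifferentiableAt ℂ f z := by
    intro z hz
    have h1 := Metric.mem_ball.1 hz.1
    have h2 := not_le.1 (mt Metric.mem_closedBall.2 hz.2)
    exact hdat z (hann z (by linarith) (by linarith)) h1.ne
  -- the Cauchy integral over an annulus not containing the point vanishes
  have hzero : ∀ a b, r - ε ≤ a → a ≤ b → b ≤ r + ε →
      (∀ z ∈ Metric.ball c b \ Metric.closedBall c a, DifferentiableAt ℂ f z) →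
      ∀ z, z ∉ Metric.closedBall c b \ Metric.ball c a →
      (∮ w in C(c, b), (w - z)⁻¹ * f w) = ∮ w in C(c, a), (w - z)⁻¹ * f w := by
    intro a b ha hab hb hdf z hz
    refine Complex.circleIntegral_eq_of_differentiable_on_annulus_off_countable (by linarith) hab
      Set.countable_empty ?_ fun w hw => ?_
    · exact ((continuousOn_id.sub continuousOn_const).inv₀ fun w hw => sub_ne_zero.2
        fun h => hz (by rw [← show w = z from h]; exact hw)).mul (hcont a b ha hb)
    · refine ((differentiableAt_id.sub_const z).inv (sub_ne_zero.2 fun h => hz ?_)).mul (hdf w hw.1)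
      rw [← h]
      exact ⟨Metric.ball_subset_closedBall hw.1.1, fun h => hw.1.2 (Metric.ball_subset_closedBall h)⟩
  -- `F` sees only the two boundary circles of the annulus, so it is holomorphic across the middle
  -- circle. Off that circle `f = F`: use the integral formula on the half-annulus containing `z`
  -- and Cauchy's theorem on the other half. Density and continuity extend the equality.
  set F : ℂ → ℂ := fun z => (2 * Real.pi * Complex.I)⁻¹ *
    ((∮ w in C(c, r + ε), (w - z)⁻¹ * f w) - ∮ w in C(c, r - ε), (w - z)⁻¹ * f w) with hF
  set A : Set ℂ := Metric.ball c (r + ε) \ Metric.closedBall c (r - ε)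
  have hA : IsOpen A := Metric.isOpen_ball.sdiff Metric.isClosed_closedBall
  have hAU : A ⊆ U := fun z hz => by
    have h1 := Metric.mem_ball.1 hz.1
    have h2 := not_le.1 (mt Metric.mem_closedBall.2 hz.2)
    exact hann z (by linarith) (by linarith)
  have hFd : DifferentiableOn ℂ F A := fun z hz => by
    have h1 := Metric.mem_ball.1 hz.1
    have h2 := not_le.1 (mt Metric.mem_closedBall.2 hz.2)
    exact (((differentiableAt_cauchyIntegral (by linarith) (hsph _ (by linarith) le_rfl)
      (fun h => absurd (Metric.mem_sphere.1 h) (by linarith))).sub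
      (differentiableAt_cauchyIntegral (by linarith) (hsph _ le_rfl (by linarith))
      (fun h => absurd (Metric.mem_sphere.1 h) (by linarith)))).const_mul _).differentiableWithinAt
  have hoff : ∀ z ∈ A \ Metric.sphere c r, f z = F z := by
    intro z hz
    have h1 := Metric.mem_ball.1 hz.1.1
    have h2 := not_le.1 (mt Metric.mem_closedBall.2 hz.1.2)
    rcases lt_or_gt_of_ne (show dist z c ≠ r from hz.2) with h | h
    · have e1 := cauchyFormula_annulus (by linarith) (by linarith)
        (hcont (r - ε) r le_rfl (by linarith)) hdiff2 (z := z) ⟨h, hz.1.2⟩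
      have e2 := hzero r (r + ε) (by linarith) (by linarith) le_rfl hdiff1 z fun hh => hh.2 h
      simp only [hF, e2, e1]
      field_simp
    · have e1 := cauchyFormula_annulus hr (by linarith)
        (hcont r (r + ε) (by linarith) le_rfl) hdiff1 (z := z)
        ⟨hz.1.1, fun hh => absurd (Metric.mem_closedBall.1 hh) (by linarith)⟩
      have e2 := hzero (r - ε) r le_rfl (by linarith) (by linarith) hdiff2 z
        fun hh => absurd (Metric.mem_closedBall.1 hh.1) (by linarith)
      simp only [hF, ← e2, e1]
      field_simp
  have hz₀A : z₀ ∈ A := ⟨Metric.mem_ball.2 (by linarith),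
    fun h => absurd (Metric.mem_closedBall.1 h) (by linarith)⟩
  have hdense : Dense (Metric.sphere c r)ᶜ :=
    Measure.dense_of_ae (μ := (volume : Measure ℂ)) (by
      rw [ae_iff]; simpa only [Set.mem_compl_iff, not_not, Set.ofPred_mem_eq] using Measure.addHaar_sphere (volume : Measure ℂ) c r)
  have heq : Set.EqOn f F A := by
    refine Set.EqOn.of_subset_closure (s := A \ Metric.sphere c r) hoff (hc.mono hAU)
      hFd.continuousOn Set.sdiff_subset ?_
    exact hdense.open_subset_closure_inter hA
  exact ((hFd z₀ hz₀A).differentiableAt (hA.mem_nhds hz₀A)).congr_of_eventuallyEq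
    (eventually_of_mem (hA.mem_nhds hz₀A) heq) |>.differentiableWithinAt

/-- An entire function of growth `O(z^{k-1})` is a polynomial of degree less than `k`. -/
theorem exists_polynomial_of_isBigO {k : ℕ} {f : ℂ → ℂ} (hf : Differentiable ℂ f)
    (hO : f =O[Bornology.cobounded ℂ] fun z => z ^ k * z⁻¹) :
    ∃ p ∈ Polynomial.degreeLT ℂ k, ∀ z, f z = p.eval z := by
  induction k generalizing f with
  | zero =>
    refine ⟨0, Submodule.zero_mem _, fun z => ?_⟩
    simp only [Polynomial.eval_zero]
    refine hf.apply_eq_of_tendsto_cocompact z ?_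
    rw [← Metric.cobounded_eq_cocompact]
    refine hO.trans_tendsto ?_
    simpa using tendsto_inv₀_cobounded (α := ℂ)
  | succ k ih =>
    -- Passing to `(f z - f 0) / z` lowers the growth order by one; the base case is decay at
    -- infinity, where Liouville gives zero.
    have hg : Differentiable ℂ (dslope f 0) := by
      rw [← differentiableOn_univ] at hf ⊢
      exact (Complex.differentiableOn_dslope univ_mem).2 hf
    have hne : ∀ᶠ z : ℂ in Bornology.cobounded ℂ, z ≠ 0 :=
      (Metric.hasBasis_cobounded_compl_closedBall (0 : ℂ)).eventually_iff.2 ⟨1, trivial, fun z hz h => hz (by simp [h])⟩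
    have hO1 : (fun z => f z - f 0) =O[Bornology.cobounded ℂ] fun z : ℂ => z ^ k := by
      refine Asymptotics.IsBigO.sub (hO.congr' EventuallyEq.rfl ?_) ?_
      · filter_upwards [hne] with z hz
        rw [pow_succ]; field_simp
      · refine Asymptotics.IsBigO.of_bound ‖f 0‖ ?_
        filter_upwards [(Metric.hasBasis_cobounded_compl_closedBall (0 : ℂ)).eventually_iff.2
          ⟨1, trivial, fun z hz => (not_le.1 (by simpa using hz) : 1 < ‖z‖)⟩] with z hz
        rw [norm_pow]
        exact le_mul_of_one_le_right (norm_nonneg _) (one_le_pow₀ hz.le)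
    obtain ⟨p, hp, hpe⟩ := ih hg (by
      refine (hO1.mul (Asymptotics.isBigO_refl (fun z : ℂ => z⁻¹) _)).congr' ?_ EventuallyEq.rfl
      filter_upwards [hne] with z hz
      rw [dslope_of_ne _ hz, slope_def_field, sub_zero, div_eq_mul_inv])
    refine ⟨Polynomial.C (f 0) + Polynomial.X * p, ?_, fun z => ?_⟩
    · rw [Polynomial.mem_degreeLT, Polynomial.degree_lt_iff_coeff_zero] at hp ⊢
      intro l hl
      obtain ⟨l, rfl⟩ : ∃ l', l = l' + 1 := ⟨l - 1, by omega⟩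
      rw [Polynomial.coeff_add, Polynomial.coeff_C_succ, Polynomial.coeff_X_mul, hp l (by omega),
        zero_add]
    · have := sub_smul_dslope f 0 z
      simp only [sub_zero, smul_eq_mul, hpe] at this
      simp only [Polynomial.eval_add, Polynomial.eval_C, Polynomial.eval_mul, Polynomial.eval_X]
      linear_combination -this

/-! ### Nested contours and gluing across them -/

namespace CircleSystem

variable {N : ℕ} (S : CircleSystem N)

theorem isClosed_support : IsClosed S.support :=
  isClosed_iUnion_of_finite fun _ => Metric.isClosed_sphere

theorem isCompact_support : IsCompact S.support :=
  isCompact_iUnion fun _ => isCompact_sphere _ _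

theorem dense_compl_support : Dense S.supportᶜ :=
  Measure.dense_of_ae (μ := (volume : Measure ℂ)) (by
    rw [ae_iff]
    simp only [not_not, Set.ofPred_mem_eq]
    exact measure_iUnion_null fun i => Measure.addHaar_sphere _ _ _)

theorem plusRegion_union_minusRegion : S.plusRegion ∪ S.minusRegion = S.supportᶜ := by
  ext z
  simp only [plusRegion, minusRegion, Set.mem_union, Set.mem_compl_iff, Set.mem_ofPred_eq]
  tauto

theorem plusRegion_subset : S.plusRegion ⊆ S.supportᶜ := fun _ hz => hz.1

theorem minusRegion_subset : S.minusRegion ⊆ S.supportᶜ := fun _ hz h => hz (Or.inr h)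

/-- The union of the circles other than the `i`-th one. -/
def otherCircles (i : Fin N) : Set ℂ := ⋃ j ∈ {j | j ≠ i}, Metric.sphere (S.center j) (S.radius j)

theorem isClosed_otherCircles (i : Fin N) : IsClosed (S.otherCircles i) :=
  (Set.toFinite _).isClosed_biUnion fun _ _ => Metric.isClosed_sphere

theorem disjoint_otherCircles (hdisj : Pairwise fun i j => Disjoint
    (Metric.sphere (S.center i) (S.radius i)) (Metric.sphere (S.center j) (S.radius j)))
    {i : Fin N} {ζ : ℂ} (hζ : ζ ∈ Metric.sphere (S.center i) (S.radius i)) :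
    ζ ∉ S.otherCircles i := by
  simp only [otherCircles, Set.mem_iUnion, Set.mem_ofPred_eq, not_exists]
  exact fun j hj h => Set.disjoint_left.1 (hdisj hj) h hζ

/-- Disjoint circles are removable for continuous functions. -/
theorem differentiable_of_off_support (hdisj : Pairwise fun i j => Disjoint
    (Metric.sphere (S.center i) (S.radius i)) (Metric.sphere (S.center j) (S.radius j)))
    {f : ℂ → ℂ} (hc : Continuous f) (hd : DifferentiableOn ℂ f S.supportᶜ) :
    Differentiable ℂ f := by
  intro z
  by_cases hz : z ∈ S.support
  · obtain ⟨i, hi⟩ := Set.mem_iUnion.1 hz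
    have hU := (S.isClosed_otherCircles i).isOpen_compl
    refine (differentiableOn_of_off_sphere (S.radius_pos i) hU
      (fun ζ hζ => S.disjoint_otherCircles hdisj hζ) hc.continuousOn (hd.mono ?_)).differentiableAt
      (hU.mem_nhds (S.disjoint_otherCircles hdisj hi))
    rintro w ⟨hw, hwi⟩ h
    obtain ⟨j, hj⟩ := Set.mem_iUnion.1 h
    by_cases hji : j = i
    · exact hwi (hji ▸ hj)
    · exact hw (Set.mem_biUnion (show j ∈ {j | j ≠ i} from hji) hj)
  · exact (hd z hz).differentiableAt (S.isClosed_support.isOpen_compl.mem_nhds hz)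

variable {M : ℕ} {S : CircleSystem (M + 1)}

/-- The contour consists of a counterclockwise circle about the origin and clockwise circles around
disjoint closed discs in its interior. -/
structure IsNested (S : CircleSystem (M + 1)) : Prop where
  center_zero : S.center 0 = 0
  orient_zero : S.orient 0 = 1
  orient_succ : ∀ i : Fin M, S.orient i.succ = -1
  subset_ball : ∀ i : Fin M, Metric.closedBall (S.center i.succ) (S.radius i.succ) ⊆
    Metric.ball 0 (S.radius 0)
  pairwise_disjoint : Pairwise fun i j : Fin M =>
    Disjoint (Metric.closedBall (S.center i.succ) (S.radius i.succ))
      (Metric.closedBall (S.center j.succ) (S.radius j.succ))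

/-- The union of the closed discs around which the clockwise circles run. -/
def holes (S : CircleSystem (M + 1)) : Set ℂ :=
  ⋃ i : Fin M, Metric.closedBall (S.center i.succ) (S.radius i.succ)

theorem isClosed_holes : IsClosed S.holes :=
  isClosed_iUnion_of_finite fun _ => Metric.isClosed_closedBall

namespace IsNested

theorem holes_subset (h : S.IsNested) : S.holes ⊆ Metric.ball 0 (S.radius 0) :=
  Set.iUnion_subset h.subset_ball

theorem mem_support (h : S.IsNested) {z : ℂ} : z ∈ S.support ↔
    ‖z‖ = S.radius 0 ∨ ∃ i : Fin M, z ∈ Metric.sphere (S.center i.succ) (S.radius i.succ) := by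
  simp only [support, Set.mem_iUnion, Fin.exists_fin_succ, h.center_zero, mem_sphere_zero_iff_norm]

theorem norm_lt (h : S.IsNested) {i : Fin M} {z : ℂ}
    (hz : z ∈ Metric.closedBall (S.center i.succ) (S.radius i.succ)) : ‖z‖ < S.radius 0 := by
  simpa using h.subset_ball i hz

theorem pairwise_disjoint_sphere (h : S.IsNested) : Pairwise fun i j => Disjoint
    (Metric.sphere (S.center i) (S.radius i)) (Metric.sphere (S.center j) (S.radius j)) := by
  have h0 : ∀ j : Fin M, Disjoint (Metric.sphere (S.center 0) (S.radius 0))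
      (Metric.sphere (S.center j.succ) (S.radius j.succ)) := fun j =>
    Set.disjoint_left.2 fun z hz hz' => by
      have := h.norm_lt (Metric.sphere_subset_closedBall hz')
      rw [h.center_zero, mem_sphere_zero_iff_norm] at hz
      linarith
  intro i j hij
  refine Fin.cases ?_ (fun i => ?_) i (motive := fun i => i ≠ j → Disjoint
    (Metric.sphere (S.center i) (S.radius i)) (Metric.sphere (S.center j) (S.radius j))) hij
  · refine Fin.cases (fun h => absurd rfl h) (fun j _ => h0 j) j
  · refine Fin.cases (fun _ => (h0 i).symm) (fun j hij => ?_) j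
    exact (h.pairwise_disjoint fun hh => hij (congrArg Fin.succ hh)).mono
      Metric.sphere_subset_closedBall Metric.sphere_subset_closedBall

theorem winding_eq (h : S.IsNested) {z : ℂ} (hz : z ∉ S.holes) :
    S.winding z = (Metric.ball 0 (S.radius 0)).indicator (fun _ => 1) z := by
  rw [winding, Fin.sum_univ_succ, h.center_zero, h.orient_zero, Finset.sum_eq_zero, add_zero]
  · rfl
  · intro i _
    exact Set.indicator_of_notMem (fun hi => hz (Set.mem_iUnion.2
      ⟨i, Metric.ball_subset_closedBall hi⟩)) _

theorem plusRegion_subset_ball (h : S.IsNested) : S.plusRegion ⊆ Metric.ball 0 (S.radius 0) := by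
  intro z hz
  by_contra hzb
  have := h.winding_eq (z := z) fun hh => hzb (h.holes_subset hh)
  rw [Set.indicator_of_notMem hzb, hz.2] at this
  exact one_ne_zero this

/-- Inside the outer circle and off the holes the winding number is one. Thus near the outer circle
`Ω₋` is the exterior only, which identifies the one-sided limits there. -/
theorem minusRegion_diff_holes_subset (h : S.IsNested) :
    S.minusRegion \ S.holes ⊆ (Metric.ball 0 (S.radius 0))ᶜ := fun z hz hzb =>
  hz.1 (Or.inl ⟨minusRegion_subset S hz.1, by
    rw [h.winding_eq hz.2, Set.indicator_of_mem hzb]⟩)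

theorem notMem_holes (h : S.IsNested) {ζ : ℂ} (hζ : S.radius 0 ≤ ‖ζ‖) : ζ ∉ S.holes := fun hh => by
  have := h.holes_subset hh
  rw [mem_ball_zero_iff] at this
  linarith

open Classical in
/-- Functions on the complement of the contour that match after multiplication by `α` inside and
`β` outside of the outer circle define an entire function. -/
theorem exists_entire (h : S.IsNested) {ψ α β : ℂ → ℂ} (hα : Differentiable ℂ α)
    (hβ : Differentiable ℂ β) (hψ : DifferentiableOn ℂ ψ S.supportᶜ)
    (hlim : ∀ ζ ∈ S.support, ∃ x y : ℂ, Tendsto ψ (𝓝[S.plusRegion] ζ) (𝓝 x) ∧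
      Tendsto ψ (𝓝[S.minusRegion] ζ) (𝓝 y) ∧
      (‖ζ‖ = S.radius 0 → α ζ * x = β ζ * y) ∧ (‖ζ‖ ≠ S.radius 0 → x = y)) :
    ∃ E : ℂ → ℂ, Differentiable ℂ E ∧ ∀ z ∉ S.support,
      (‖z‖ < S.radius 0 → E z = α z * ψ z) ∧ (S.radius 0 < ‖z‖ → E z = β z * ψ z) := by
  set e : ℂ → ℂ := fun z => if ‖z‖ < S.radius 0 then α z * ψ z else β z * ψ z with he
  have hin : ∀ z, ‖z‖ < S.radius 0 → e =ᶠ[𝓝 z] fun w => α w * ψ w := fun z hz => by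
    filter_upwards [Metric.isOpen_ball.mem_nhds (mem_ball_zero_iff.2 hz)] with w hw
    simp only [he, if_pos (mem_ball_zero_iff.1 hw)]
  have hout : ∀ z, S.radius 0 < ‖z‖ → e =ᶠ[𝓝 z] fun w => β w * ψ w := fun z hz => by
    filter_upwards [Metric.isClosed_closedBall.isOpen_compl.mem_nhds
      (show z ∈ (Metric.closedBall 0 (S.radius 0))ᶜ by simpa using hz)] with w hw
    have : S.radius 0 < ‖w‖ := by simpa using hw
    simp only [he, if_neg this.not_gt]
  have hopen := S.isClosed_support.isOpen_compl
  have hed : DifferentiableOn ℂ e S.supportᶜ := by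
    intro z hz
    have hψz := (hψ z hz).differentiableAt (hopen.mem_nhds hz)
    rcases lt_trichotomy ‖z‖ (S.radius 0) with hlt | heq | hgt
    · exact (((hα z).mul hψz).congr_of_eventuallyEq (hin z hlt)).differentiableWithinAt
    · exact absurd (h.mem_support.2 (Or.inl heq)) hz
    · exact (((hβ z).mul hψz).congr_of_eventuallyEq (hout z hgt)).differentiableWithinAt
  -- The matching conditions make the limits from the two sides agree, so `e` extends continuously
  -- over the contour and removability of circles applies to the extension.
  have helim : ∀ ζ, ∃ y, Tendsto e (𝓝[S.supportᶜ] ζ) (𝓝 y) := by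
    intro ζ
    by_cases hζ : ζ ∈ S.support
    swap
    · exact ⟨e ζ, (hed ζ hζ).continuousWithinAt⟩
    obtain ⟨x, y, hx, hy, h1, h2⟩ := hlim ζ hζ
    rw [← S.plusRegion_union_minusRegion, nhdsWithin_union]
    have hαζ : ∀ s, Tendsto α (𝓝[s] ζ) (𝓝 (α ζ)) := fun s => (hα ζ).continuousAt.continuousWithinAt
    have hβζ : ∀ s, Tendsto β (𝓝[s] ζ) (𝓝 (β ζ)) := fun s => (hβ ζ).continuousAt.continuousWithinAt
    by_cases hn : ‖ζ‖ = S.radius 0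
    · refine ⟨α ζ * x, Tendsto.sup ?_ ?_⟩
      · refine ((hαζ _).mul hx).congr' ?_
        filter_upwards [self_mem_nhdsWithin] with w hw
        simp only [he, if_pos (mem_ball_zero_iff.1 (h.plusRegion_subset_ball hw))]
      · rw [h1 hn]
        refine ((hβζ _).mul hy).congr' ?_
        filter_upwards [self_mem_nhdsWithin, mem_nhdsWithin_of_mem_nhds
          (isClosed_holes.isOpen_compl.mem_nhds (h.notMem_holes hn.ge))] with w hw hw'
        have := h.minusRegion_diff_holes_subset ⟨hw, hw'⟩
        simp only [Set.mem_compl_iff, mem_ball_zero_iff] at this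
        simp only [he, if_neg this]
    · obtain ⟨i, hi⟩ := (h.mem_support.1 hζ).resolve_left hn
      have hlt := h.norm_lt (Metric.sphere_subset_closedBall hi)
      have := h2 hn
      subst this
      exact ⟨α ζ * x, Tendsto.sup
        (((hαζ _).mul hx).congr' (mem_nhdsWithin_of_mem_nhds (hin ζ hlt).symm))
        (((hαζ _).mul hy).congr' (mem_nhdsWithin_of_mem_nhds (hin ζ hlt).symm))⟩
  have heq : ∀ z ∉ S.support, extendFrom S.supportᶜ e z = e z := fun z hz =>
    extendFrom_eq (S.dense_compl_support z) (hed z hz).continuousWithinAt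
  refine ⟨extendFrom S.supportᶜ e, S.differentiable_of_off_support h.pairwise_disjoint_sphere
    (continuous_extendFrom S.dense_compl_support helim) (hed.congr fun z hz => heq z hz),
    fun z hz => ⟨fun hlt => ?_, fun hgt => ?_⟩⟩
  · rw [heq z hz, he]; exact if_pos hlt
  · rw [heq z hz, he]; exact if_neg hgt.not_gt

end IsNested

/-! ### Triangular jumps and the nullity of the Riemann–Hilbert problem -/

open Classical in
/-- The piecewise power which is `ζ ^ e` on the circle of radius `R` about the origin and `1`
elsewhere. -/
def outerPow (R : ℝ) (e : ℤ) (ζ : ℂ) : ℂ := if ‖ζ‖ = R then ζ ^ e else 1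

theorem outerPow_of_eq {R : ℝ} {e : ℤ} {ζ : ℂ} (h : ‖ζ‖ = R) : outerPow R e ζ = ζ ^ e := if_pos h

theorem outerPow_of_ne {R : ℝ} {e : ℤ} {ζ : ℂ} (h : ‖ζ‖ ≠ R) : outerPow R e ζ = 1 := if_neg h

theorem outerPow_neg {R : ℝ} {e : ℤ} {ζ : ℂ} : outerPow R (-e) ζ = (outerPow R e ζ)⁻¹ := by
  by_cases h : ‖ζ‖ = R
  · rw [outerPow_of_eq h, outerPow_of_eq h, zpow_neg]
  · rw [outerPow_of_ne h, outerPow_of_ne h, inv_one]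

theorem outerPow_ne_zero {R : ℝ} (hR : 0 < R) {e : ℤ} {ζ : ℂ} : outerPow R e ζ ≠ 0 := by
  by_cases h : ‖ζ‖ = R
  · rw [outerPow_of_eq h]
    exact zpow_ne_zero _ (norm_pos_iff.1 (h ▸ hR))
  · rw [outerPow_of_ne h]; exact one_ne_zero

/-- A lower triangular jump matrix with diagonal `(ζ ^ k, ζ ^ (-k))` on the outer circle and unit
diagonal on the inner circles. -/
def triJump (R : ℝ) (k : ℕ) (b : ℂ → ℂ) (ζ : ℂ) : Matrix (Fin 2) (Fin 2) ℂ :=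
  !![outerPow R k ζ, 0; b ζ, outerPow R (-k) ζ]

theorem triJump_inv {R : ℝ} (hR : 0 < R) (k : ℕ) (b : ℂ → ℂ) (ζ : ℂ) :
    (triJump R k b ζ)⁻¹ = !![outerPow R (-k) ζ, 0; -b ζ, outerPow R k ζ] := by
  refine Matrix.inv_eq_right_inv ?_
  have h1 : outerPow R k ζ * outerPow R (-k) ζ = 1 := by
    rw [outerPow_neg, mul_inv_cancel₀ (outerPow_ne_zero hR)]
  rw [triJump, Matrix.mul_fin_two, Matrix.one_fin_two]
  simp only [h1, mul_comm (outerPow R (-k) ζ), mul_zero, zero_mul, add_zero, zero_add]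
  congr 4; ring

open Classical in
/-- The second row of a solution of the associated homogeneous problem with polynomial data `p`. -/
def rhpEntry (S : CircleSystem (M + 1)) (k : ℕ) (p : Polynomial ℂ) (z : ℂ) : ℂ :=
  if z ∈ S.support then 0 else if ‖z‖ < S.radius 0 then p.eval z else (z ^ k)⁻¹ * p.eval z

/-- The solution of the associated homogeneous problem with polynomial data `p`. -/
def rhpSolution (S : CircleSystem (M + 1)) (k : ℕ) :
    (Fin 2 → Polynomial.degreeLT ℂ k) →ₗ[ℂ] (ℂ → Matrix (Fin 2) (Fin 2) ℂ) where
  toFun p := fun z => Matrix.of ![0, fun j => S.rhpEntry k (p j) z]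
  map_add' p q := by
    ext z i j
    fin_cases i <;> simp [rhpEntry]
    split_ifs <;> ring
  map_smul' c p := by
    ext z i j
    fin_cases i <;> simp [rhpEntry]
    split_ifs <;> ring

end CircleSystem

theorem eval_eq_sum_of_mem_degreeLT {k : ℕ} {p : Polynomial ℂ} (hp : p ∈ Polynomial.degreeLT ℂ k)
    (z : ℂ) : p.eval z = ∑ j ∈ Finset.range k, p.coeff j * z ^ j := by
  rcases Nat.eq_zero_or_pos k with rfl | hk
  -- The case `k = 0` is separate because the zero polynomial has `natDegree = 0`, which is not less
  -- than `k`.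
  · rw [Polynomial.mem_degreeLT, Nat.cast_zero, Nat.WithBot.lt_zero_iff,
      Polynomial.degree_eq_bot] at hp
    simp [hp]
  · refine Polynomial.eval_eq_sum_range' ?_ z
    rw [Polynomial.mem_degreeLT] at hp
    rcases eq_or_ne p 0 with rfl | h0
    · simpa using hk
    · exact (Polynomial.natDegree_lt_iff_degree_lt h0).2 hp

/-- A polynomial of degree less than `k` decays after division by `z ^ k`. -/
theorem isBigO_inv_pow_mul_eval {k : ℕ} {p : Polynomial ℂ} (hp : p ∈ Polynomial.degreeLT ℂ k) :
    (fun z => (z ^ k)⁻¹ * p.eval z) =O[Bornology.cobounded ℂ] fun z : ℂ => z⁻¹ := by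
  simp only [eval_eq_sum_of_mem_degreeLT hp, Finset.mul_sum]
  refine Asymptotics.IsBigO.fun_sum fun j hj => ?_
  refine Asymptotics.IsBigO.of_bound ‖p.coeff j‖ ?_
  filter_upwards [(Metric.hasBasis_cobounded_compl_closedBall (0 : ℂ)).eventually_iff.2
    ⟨1, trivial, fun z hz => (not_le.1 (by simpa using hz) : 1 < ‖z‖)⟩] with z hz
  have hz0 : z ≠ 0 := norm_pos_iff.1 (one_pos.trans hz)
  have hjk : k = j + (k - 1 - j) + 1 := by have := Finset.mem_range.1 hj; omega
  have h1 : ‖(z ^ (k - 1 - j))⁻¹‖ ≤ 1 := by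
    rw [norm_inv, norm_pow]
    exact inv_le_one_of_one_le₀ (one_le_pow₀ hz.le)
  have h2 : (z ^ k)⁻¹ * (p.coeff j * z ^ j) = p.coeff j * ((z ^ (k - 1 - j))⁻¹ * z⁻¹) := by
    have : z ^ k = z ^ j * z ^ (k - 1 - j) * z := by
      rw [← pow_add, ← pow_succ, ← hjk]
    rw [this]; field_simp
  rw [h2, norm_mul, norm_mul]
  refine mul_le_mul_of_nonneg_left ?_ (norm_nonneg _)
  exact mul_le_of_le_one_left (norm_nonneg _) h1

theorem rank_pi_degreeLT (k : ℕ) :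
    Module.rank ℂ (Fin 2 → Polynomial.degreeLT ℂ k) = ((2 * k : ℕ) : Cardinal) := by
  have := Module.Finite.equiv (Polynomial.degreeLTEquiv ℂ k).symm
  rw [← Module.finrank_eq_rank, Module.finrank_pi_fintype]
  simp [(Polynomial.degreeLTEquiv ℂ k).finrank_eq]

namespace CircleSystem

variable {M : ℕ} {S : CircleSystem (M + 1)}

theorem tendsto_matrix_iff {l : Filter ℂ} {Ψ : ℂ → Matrix (Fin 2) (Fin 2) ℂ}
    {A : Matrix (Fin 2) (Fin 2) ℂ} :
    Tendsto Ψ l (𝓝 A) ↔ ∀ i j, Tendsto (fun z => Ψ z i j) l (𝓝 (A i j)) :=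
  Iff.trans (tendsto_pi_nhds (f := fun z i => Ψ z i)) (forall_congr' fun _ => tendsto_pi_nhds)

theorem rhpEntry_of_lt {k : ℕ} {p : Polynomial ℂ} {z : ℂ} (hz : z ∉ S.support)
    (h : ‖z‖ < S.radius 0) : S.rhpEntry k p z = p.eval z := by
  rw [rhpEntry, if_neg hz, if_pos h]

theorem rhpEntry_of_ge {k : ℕ} {p : Polynomial ℂ} {z : ℂ} (hz : z ∉ S.support)
    (h : ¬ ‖z‖ < S.radius 0) : S.rhpEntry k p z = (z ^ k)⁻¹ * p.eval z := by
  rw [rhpEntry, if_neg hz, if_neg h]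

theorem isOpen_compl_support_inter_ball : IsOpen (S.supportᶜ ∩ Metric.ball 0 (S.radius 0)) :=
  S.isClosed_support.isOpen_compl.inter Metric.isOpen_ball

/-- A solution equals its polynomial on the nonempty open set of points of the disc off the contour,
and this determines the polynomial. -/
theorem rhpSolution_injective (k : ℕ) : Function.Injective (S.rhpSolution k) := by
  intro p q hpq
  funext j
  ext1
  have hR := S.radius_pos 0
  have hne : (S.supportᶜ ∩ Metric.ball 0 (S.radius 0)).Nonempty := by
    rw [Set.inter_comm]
    exact S.dense_compl_support.inter_open_nonempty _ Metric.isOpen_ball ⟨0, by simpa using hR⟩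
  obtain ⟨z₀, hz₀⟩ := hne
  refine Polynomial.eq_of_infinite_eval_eq _ _ ?_
  exact infinite_of_mem_nhds z₀ (by
    filter_upwards [isOpen_compl_support_inter_ball.mem_nhds hz₀] with z hz
    have := congrFun (congrFun (congrFun hpq z) 1) j
    simp only [rhpSolution, LinearMap.coe_mk, AddHom.coe_mk, Matrix.of_apply, Matrix.cons_val_one,
      Matrix.cons_val_fin_one] at this
    rwa [rhpEntry_of_lt hz.1 (mem_ball_zero_iff.1 hz.2),
      rhpEntry_of_lt hz.1 (mem_ball_zero_iff.1 hz.2)] at this)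

namespace IsNested

theorem differentiableOn_rhpEntry (h : S.IsNested) (k : ℕ) (p : Polynomial ℂ) :
    DifferentiableOn ℂ (S.rhpEntry k p) S.supportᶜ := by
  intro z hz
  rcases lt_trichotomy ‖z‖ (S.radius 0) with hlt | heq | hgt
  · refine ((p.differentiable z).congr_of_eventuallyEq ?_).differentiableWithinAt
    filter_upwards [isOpen_compl_support_inter_ball.mem_nhds ⟨hz, mem_ball_zero_iff.2 hlt⟩]
      with w hw
    exact rhpEntry_of_lt hw.1 (mem_ball_zero_iff.1 hw.2)
  · exact absurd (h.mem_support.2 (Or.inl heq)) hz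
  · have hz0 : z ≠ 0 := norm_pos_iff.1 ((S.radius_pos 0).trans hgt)
    refine ((((differentiableAt_id.pow k).inv (pow_ne_zero k hz0)).mul
      (p.differentiable z)).congr_of_eventuallyEq ?_).differentiableWithinAt
    filter_upwards [S.isClosed_support.isOpen_compl.mem_nhds hz,
      (continuous_norm.tendsto z).eventually (lt_mem_nhds hgt)] with w hw hw'
    exact rhpEntry_of_ge hw hw'.not_gt

/-- With first row zero, `b` plays no role. The second row changes by the factor `ζ ^ k` across the
outer circle and not at all across the inner ones. -/
theorem rhpSolution_mem (h : S.IsNested) {k : ℕ} {b : ℂ → ℂ} {G : ℂ → Matrix (Fin 2) (Fin 2) ℂ}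
    (hG : ∀ ζ ∈ S.support, G ζ = triJump (S.radius 0) k b ζ)
    (p : Fin 2 → Polynomial.degreeLT ℂ k) : S.rhpSolution k p ∈ S.associatedRHP G := by
  have hR := S.radius_pos 0
  refine ⟨fun z hz => ?_, fun i j => ?_, fun ζ hζ => ?_, fun i j => ?_⟩
  · ext i j
    fin_cases i
    · simp [rhpSolution]
    · simp [rhpSolution, rhpEntry, hz]
  · fin_cases i
    · simp [rhpSolution]
    · simpa [rhpSolution] using h.differentiableOn_rhpEntry k (p j)
  · refine ⟨Matrix.of ![0, fun j => (p j : Polynomial ℂ).eval ζ],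
      Matrix.of ![0, fun j => outerPow (S.radius 0) (-k) ζ * (p j : Polynomial ℂ).eval ζ], ?_, ?_, ?_⟩
    · refine tendsto_matrix_iff.2 fun i j => ?_
      fin_cases i
      · simpa [rhpSolution] using tendsto_const_nhds
      · simp only [rhpSolution, Fin.mk_one, LinearMap.coe_mk, AddHom.coe_mk, Matrix.of_apply,
          Matrix.cons_val_one, Matrix.cons_val_fin_one]
        refine (((p j : Polynomial ℂ).continuous.tendsto ζ).mono_left nhdsWithin_le_nhds).congr' ?_
        filter_upwards [self_mem_nhdsWithin] with z hz
        exact (rhpEntry_of_lt hz.1 (mem_ball_zero_iff.1 (h.plusRegion_subset_ball hz))).symm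
    · refine tendsto_matrix_iff.2 fun i j => ?_
      fin_cases i
      · simpa [rhpSolution] using tendsto_const_nhds
      · simp only [rhpSolution, Fin.mk_one, LinearMap.coe_mk, AddHom.coe_mk, Matrix.of_apply,
          Matrix.cons_val_one, Matrix.cons_val_fin_one]
        have hp := ((p j : Polynomial ℂ).continuous.tendsto ζ).mono_left
          (nhdsWithin_le_nhds (s := S.minusRegion))
        by_cases hn : ‖ζ‖ = S.radius 0
        · have hζ0 : ζ ≠ 0 := norm_pos_iff.1 (hn ▸ hR)
          rw [outerPow_of_eq hn, zpow_neg, zpow_natCast]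
          have hinv : Tendsto (fun z : ℂ => (z ^ k)⁻¹) (𝓝[S.minusRegion] ζ) (𝓝 (ζ ^ k)⁻¹) :=
            (((continuous_pow k).tendsto ζ).inv₀ (pow_ne_zero k hζ0)).mono_left nhdsWithin_le_nhds
          refine (hinv.mul hp).congr' ?_
          filter_upwards [self_mem_nhdsWithin, mem_nhdsWithin_of_mem_nhds
            (isClosed_holes.isOpen_compl.mem_nhds (h.notMem_holes hn.ge))] with z hz hz'
          exact (rhpEntry_of_ge (minusRegion_subset S hz)
            (mt mem_ball_zero_iff.2 (h.minusRegion_diff_holes_subset ⟨hz, hz'⟩))).symm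
        · rw [outerPow_of_ne hn, one_mul]
          obtain ⟨i, hi⟩ := (h.mem_support.1 hζ).resolve_left hn
          refine hp.congr' ?_
          filter_upwards [self_mem_nhdsWithin, mem_nhdsWithin_of_mem_nhds
            (Metric.isOpen_ball.mem_nhds (mem_ball_zero_iff.2
              (h.norm_lt (Metric.sphere_subset_closedBall hi))))] with z hz hz'
          exact (rhpEntry_of_lt (minusRegion_subset S hz) (mem_ball_zero_iff.1 hz')).symm
    · rw [hG ζ hζ, triJump_inv hR]
      have := outerPow_ne_zero (R := S.radius 0) hR (e := k) (ζ := ζ)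
      ext i j
      fin_cases i <;> simp [Matrix.mul_apply, outerPow_neg, this]
  · fin_cases i
    · simpa [rhpSolution] using Asymptotics.isBigO_zero _ _
    · refine (isBigO_inv_pow_mul_eval (p j).2).congr' ?_ EventuallyEq.rfl
      filter_upwards [(Metric.hasBasis_cobounded_compl_closedBall (0 : ℂ)).eventually_iff.2
        ⟨S.radius 0, trivial, fun z hz => (not_le.1 (by simpa using hz) : S.radius 0 < ‖z‖)⟩]
        with z hz
      have hzs : z ∉ S.support := fun hs => by
        rcases h.mem_support.1 hs with h1 | ⟨i, hi⟩
        · linarith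
        · linarith [h.norm_lt (Metric.sphere_subset_closedBall hi)]
      simpa [rhpSolution] using (rhpEntry_of_ge hzs hz.not_gt).symm

theorem notMem_support_of_lt (h : S.IsNested) {z : ℂ} (hz : S.radius 0 < ‖z‖) : z ∉ S.support := by
  intro hs
  rcases h.mem_support.1 hs with h1 | ⟨i, hi⟩
  · linarith
  · linarith [h.norm_lt (Metric.sphere_subset_closedBall hi)]

theorem eventually_cobounded (R : ℝ) : ∀ᶠ z : ℂ in Bornology.cobounded ℂ, R < ‖z‖ :=
  (Metric.hasBasis_cobounded_compl_closedBall (0 : ℂ)).eventually_iff.2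
    ⟨R, trivial, fun z hz => not_le.1 (by simpa using hz)⟩

/-- Liouville's theorem is applied to each row: it kills the first, and then leaves in the second a
polynomial of degree less than `k` per column. -/
theorem range_rhpSolution (h : S.IsNested) {k : ℕ} {b : ℂ → ℂ}
    {G : ℂ → Matrix (Fin 2) (Fin 2) ℂ}
    (hG : ∀ ζ ∈ S.support, G ζ = triJump (S.radius 0) k b ζ) :
    LinearMap.range (S.rhpSolution k) = S.associatedRHP G := by
  have hR := S.radius_pos 0
  refine le_antisymm ?_ fun Ψ hΨ => ?_
  · rintro _ ⟨p, rfl⟩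
    exact h.rhpSolution_mem hG p
  obtain ⟨h1, h2, h3, h4⟩ := hΨ
  have hlim : ∀ ζ ∈ S.support, ∃ P Q : Matrix (Fin 2) (Fin 2) ℂ,
      (∀ i j, Tendsto (fun z => Ψ z i j) (𝓝[S.plusRegion] ζ) (𝓝 (P i j))) ∧
      (∀ i j, Tendsto (fun z => Ψ z i j) (𝓝[S.minusRegion] ζ) (𝓝 (Q i j))) ∧
      (∀ j, P 0 j = outerPow (S.radius 0) (-k) ζ * Q 0 j) ∧
      (∀ j, P 1 j = -b ζ * Q 0 j + outerPow (S.radius 0) k ζ * Q 1 j) := by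
    intro ζ hζ
    obtain ⟨P, Q, hP, hQ, hPQ⟩ := h3 ζ hζ
    rw [hG ζ hζ, triJump_inv hR] at hPQ
    refine ⟨P, Q, tendsto_matrix_iff.1 hP, tendsto_matrix_iff.1 hQ, fun j => ?_, fun j => ?_⟩ <;>
    · rw [hPQ, Matrix.mul_apply]
      simp
  have hrow0 : ∀ j, ∀ z ∉ S.support, Ψ z 0 j = 0 := by
    intro j
    obtain ⟨E, hE, hEeq⟩ := h.exists_entire (ψ := fun z => Ψ z 0 j) (α := fun z => z ^ k)
      (β := fun _ => 1) (differentiable_pow k) (differentiable_const _) (h2 0 j) fun ζ hζ => by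
        obtain ⟨P, Q, hP, hQ, hPQ, -⟩ := hlim ζ hζ
        refine ⟨P 0 j, Q 0 j, hP 0 j, hQ 0 j, fun hn => ?_, fun hn => ?_⟩
        · have hζ0 : ζ ≠ 0 := norm_pos_iff.1 (hn ▸ hR)
          rw [hPQ, outerPow_of_eq hn, zpow_neg, zpow_natCast]
          field_simp
        · rw [hPQ, outerPow_of_ne hn, one_mul]
    obtain ⟨p, hp, hEp⟩ := exists_polynomial_of_isBigO (k := 0) hE (by
      refine (h4 0 j).congr' ?_ (by simp)
      filter_upwards [eventually_cobounded (S.radius 0)] with z hz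
      simpa using ((hEeq z (h.notMem_support_of_lt hz)).2 hz).symm)
    have hp0 : p = 0 := by
      rwa [Polynomial.mem_degreeLT, Nat.cast_zero, Nat.WithBot.lt_zero_iff,
        Polynomial.degree_eq_bot] at hp
    have hE0 : ∀ z, E z = 0 := fun z => by rw [hEp, hp0, Polynomial.eval_zero]
    have hne : ∀ z ∉ S.support, z ≠ 0 → Ψ z 0 j = 0 := by
      intro z hz hz0
      rcases lt_trichotomy ‖z‖ (S.radius 0) with hlt | heq | hgt
      · have := (hEeq z hz).1 hlt
        rw [hE0] at this
        exact (mul_eq_zero.1 this.symm).resolve_left (pow_ne_zero k hz0)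
      · exact absurd (h.mem_support.2 (Or.inl heq)) hz
      · have := (hEeq z hz).2 hgt
        rw [hE0] at this
        simpa using this.symm
    intro z hz
    have hopen := S.isClosed_support.isOpen_compl.mem_nhds hz
    -- The identity `z ^ k * Ψ = 0` may say nothing at the origin, where the value is recovered by
    -- continuity.
    by_cases hz0 : z = 0
    · have hc : Tendsto (fun w => Ψ w 0 j) (𝓝[≠] z) (𝓝 (Ψ z 0 j)) :=
        ((h2 0 j z hz).differentiableAt hopen).continuousAt.tendsto.mono_left nhdsWithin_le_nhds
      refine tendsto_nhds_unique hc (tendsto_const_nhds.congr' ?_)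
      filter_upwards [self_mem_nhdsWithin, mem_nhdsWithin_of_mem_nhds hopen] with w hw hw'
      exact (hne w hw' (hz0 ▸ hw)).symm
    · exact hne z hz hz0
  have hrow1 : ∀ j, ∃ p : Polynomial.degreeLT ℂ k, ∀ z ∉ S.support,
      Ψ z 1 j = S.rhpEntry k p z := by
    intro j
    obtain ⟨E, hE, hEeq⟩ := h.exists_entire (ψ := fun z => Ψ z 1 j) (α := fun _ => 1)
      (β := fun z => z ^ k) (differentiable_const _) (differentiable_pow k) (h2 1 j) fun ζ hζ => by
        obtain ⟨P, Q, hP, hQ, hPQ0, hPQ1⟩ := hlim ζ hζ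
        have hQ0 : Q 0 j = 0 := by
          -- Density of the complement shows that at least one region accumulates at `ζ`. Either one
          -- suffices, since the first row's limits differ by a nonzero factor.
          have hne : (𝓝[S.plusRegion] ζ ⊔ 𝓝[S.minusRegion] ζ).NeBot := by
            rw [← nhdsWithin_union, plusRegion_union_minusRegion]
            exact mem_closure_iff_nhdsWithin_neBot.1 (S.dense_compl_support ζ)
          rcases sup_neBot.1 hne with hb | hb
          · have : P 0 j = 0 := tendsto_nhds_unique (hP 0 j) (tendsto_const_nhds.congr' (by
              filter_upwards [self_mem_nhdsWithin] with w hw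
              exact (hrow0 j w (plusRegion_subset S hw)).symm))
            rw [hPQ0] at this
            exact (mul_eq_zero.1 this).resolve_left (outerPow_ne_zero hR)
          · exact tendsto_nhds_unique (hQ 0 j) (tendsto_const_nhds.congr' (by
              filter_upwards [self_mem_nhdsWithin] with w hw
              exact (hrow0 j w (minusRegion_subset S hw)).symm))
        refine ⟨P 1 j, Q 1 j, hP 1 j, hQ 1 j, fun hn => ?_, fun hn => ?_⟩
        · rw [hPQ1, hQ0, outerPow_of_eq hn, zpow_natCast]; ring
        · rw [hPQ1, hQ0, outerPow_of_ne hn]; ring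
    obtain ⟨p, hp, hEp⟩ := exists_polynomial_of_isBigO (k := k) hE (by
      refine ((Asymptotics.isBigO_refl (fun z : ℂ => z ^ k) _).mul (h4 1 j)).congr' ?_
        EventuallyEq.rfl
      filter_upwards [eventually_cobounded (S.radius 0)] with z hz
      exact ((hEeq z (h.notMem_support_of_lt hz)).2 hz).symm)
    refine ⟨⟨p, hp⟩, fun z hz => ?_⟩
    rcases lt_trichotomy ‖z‖ (S.radius 0) with hlt | heq | hgt
    · rw [rhpEntry_of_lt hz hlt, ← hEp, (hEeq z hz).1 hlt, one_mul]
    · exact absurd (h.mem_support.2 (Or.inl heq)) hz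
    · have hz0 : z ≠ 0 := norm_pos_iff.1 (hR.trans hgt)
      rw [rhpEntry_of_ge hz hgt.not_gt, ← hEp, (hEeq z hz).2 hgt]
      field_simp
  choose p hp using hrow1
  refine ⟨p, ?_⟩
  ext z i j
  by_cases hz : z ∈ S.support
  · rw [h1 z hz, (h.rhpSolution_mem hG p).1 z hz]
  · fin_cases i
    · simpa [rhpSolution] using (hrow0 j z hz).symm
    · simpa [rhpSolution] using (hp j z hz).symm

theorem rank_associatedRHP (h : S.IsNested) {k : ℕ} {b : ℂ → ℂ}
    {G : ℂ → Matrix (Fin 2) (Fin 2) ℂ}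
    (hG : ∀ ζ ∈ S.support, G ζ = triJump (S.radius 0) k b ζ) :
    Module.rank ℂ (S.associatedRHP G) = ((2 * k : ℕ) : Cardinal) := by
  rw [← h.range_rhpSolution hG, rank_range_of_injective _ (rhpSolution_injective k),
    rank_pi_degreeLT]

end IsNested

end CircleSystem

/-! ### Measure and integration on the contour -/

namespace CircleSystem

variable {N : ℕ} (S : CircleSystem N)

instance isFiniteMeasure_arcLength : IsFiniteMeasure S.arcLength := by
  unfold arcLength
  have : ∀ i, IsFiniteMeasure (ENNReal.ofReal (S.radius i) •
      (volume.restrict (Set.Ioc 0 (2 * Real.pi))).map (circleMap (S.center i) (S.radius i))) :=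
    fun i => Measure.smul_finite _ ENNReal.ofReal_ne_top
  infer_instance

theorem arcLength_eq_zero {s : Set ℂ} (hs : MeasurableSet s)
    (h : ∀ i, volume (circleMap (S.center i) (S.radius i) ⁻¹' s) = 0) : S.arcLength s = 0 := by
  rw [arcLength, Measure.finsetSum_apply]
  refine Finset.sum_eq_zero fun i _ => ?_
  rw [Measure.smul_apply, Measure.map_apply (measurable_circleMap _ _) hs,
    Measure.restrict_apply (measurable_circleMap _ _ hs),
    measure_mono_null Set.inter_subset_left (h i), smul_zero]

theorem ae_mem_support : ∀ᵐ ζ ∂S.arcLength, ζ ∈ S.support := by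
  refine S.arcLength_eq_zero S.isClosed_support.measurableSet.compl fun i => ?_
  have : circleMap (S.center i) (S.radius i) ⁻¹' S.supportᶜ = ∅ :=
    Set.eq_empty_of_forall_notMem fun θ hθ => hθ (Set.mem_iUnion.2
      ⟨i, circleMap_mem_sphere _ (S.radius_pos i).le θ⟩)
  exact (congrArg volume this).trans measure_empty

/-- Allows the diagonal `η = ζ` of the kernels to be ignored under the integral. -/
theorem ae_ne (z : ℂ) : ∀ᵐ ζ ∂S.arcLength, ζ ≠ z := by
  have : S.arcLength {z} = 0 := S.arcLength_eq_zero (measurableSet_singleton z) fun i =>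
    ((Set.countable_singleton z).preimage_circleMap _ (S.radius_pos i).ne').measure_zero _
  exact measure_eq_zero_iff_ae_notMem.1 this

theorem contourIntegrable_of_integrable {f : ℂ → ℂ} (hf : Integrable f S.arcLength) :
    S.ContourIntegrable f := by
  intro i
  have hle : ENNReal.ofReal (S.radius i) •
      (volume.restrict (Set.Ioc 0 (2 * Real.pi))).map (circleMap (S.center i) (S.radius i))
        ≤ S.arcLength :=
    Finset.single_le_sum (f := fun i => ENNReal.ofReal (S.radius i) •
      (volume.restrict (Set.Ioc 0 (2 * Real.pi))).map (circleMap (S.center i) (S.radius i)))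
      (fun _ _ => Measure.zero_le _) (Finset.mem_univ i)
  have h1 := (integrable_smul_measure (by simpa using S.radius_pos i) ENNReal.ofReal_ne_top).1
    (hf.mono_measure hle)
  rw [integrable_map_measure h1.1 (measurable_circleMap _ _).aemeasurable] at h1
  rw [CircleIntegrable, intervalIntegrable_iff_integrableOn_Ioc_of_le Real.two_pi_pos.le]
  exact h1

theorem contourIntegrable_Lp (u : Lp ℂ 2 S.arcLength) : S.ContourIntegrable u :=
  S.contourIntegrable_of_integrable ((Lp.memLp u).integrable one_le_two)

theorem memLp_of_bound {f : ℂ → ℂ} (hf : Measurable f) {C : ℝ} (hC : ∀ ζ ∈ S.support, ‖f ζ‖ ≤ C) :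
    MemLp f 2 S.arcLength :=
  MemLp.of_bound hf.aestronglyMeasurable C (by
    filter_upwards [S.ae_mem_support] with ζ hζ using hC ζ hζ)

theorem contourIntegrable_of_bound {f : ℂ → ℂ} (hf : Measurable f) {C : ℝ}
    (hC : ∀ ζ ∈ S.support, ‖f ζ‖ ≤ C) : S.ContourIntegrable f :=
  S.contourIntegrable_of_integrable ((S.memLp_of_bound hf hC).integrable one_le_two)

theorem sphere_subset_support (i : Fin N) :
    Metric.sphere (S.center i) (S.radius i) ⊆ S.support := fun _ h => Set.mem_iUnion.2 ⟨i, h⟩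

theorem ContourIntegrable.bdd_mul {f κ : ℂ → ℂ} (hf : S.ContourIntegrable f) (hκ : Measurable κ)
    {C : ℝ} (hC : ∀ ζ ∈ S.support, ‖κ ζ‖ ≤ C) : S.ContourIntegrable fun η => κ η * f η := by
  intro i
  have h := hf i
  rw [CircleIntegrable, intervalIntegrable_iff] at h ⊢
  refine Integrable.bdd_mul (c := C) h
    (hκ.comp (measurable_circleMap _ _)).aestronglyMeasurable ?_
  exact Eventually.of_forall fun θ => hC _ (S.sphere_subset_support i
    (circleMap_mem_sphere _ (S.radius_pos i).le θ))

theorem circleIntegral_congr_ae {i : Fin N} {f g : ℂ → ℂ} (h : ∀ᵐ ζ ∂S.arcLength,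
    ζ ∈ Metric.sphere (S.center i) (S.radius i) → f ζ = g ζ) :
    (∮ z in C(S.center i, S.radius i), f z) = ∮ z in C(S.center i, S.radius i), g z := by
  simp only [circleIntegral]
  refine intervalIntegral.integral_congr_ae ?_
  rw [Set.uIoc_of_le Real.two_pi_pos.le, ← ae_restrict_iff' measurableSet_Ioc]
  filter_upwards [S.ae_circleMap h i] with θ hθ
  rw [hθ (circleMap_mem_sphere _ (S.radius_pos i).le θ)]

theorem contourIntegral_congr_support {f g : ℂ → ℂ} (h : ∀ ζ ∈ S.support, f ζ = g ζ) :
    S.contourIntegral f = S.contourIntegral g :=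
  S.contourIntegral_congr (by filter_upwards [S.ae_mem_support] with ζ hζ using h ζ hζ)

theorem measurable_circleIntegral (c : ℂ) (r : ℝ) {κ : ℂ → ℂ → ℂ}
    (hκ : Measurable (Function.uncurry κ)) : Measurable fun ζ => ∮ η in C(c, r), κ ζ η := by
  simp only [circleIntegral, intervalIntegral.integral_of_le Real.two_pi_pos.le]
  have hm : Measurable (Function.uncurry fun (ζ : ℂ) (θ : ℝ) =>
      deriv (circleMap c r) θ • κ ζ (circleMap c r θ)) := by
    have h1 : Measurable fun p : ℂ × ℝ => deriv (circleMap c r) p.2 :=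
      (measurable_deriv _).comp measurable_snd
    exact h1.smul (hκ.comp (measurable_fst.prodMk ((measurable_circleMap c r).comp measurable_snd)))
  exact hm.stronglyMeasurable.integral_prod_right.measurable

theorem measurable_contourIntegral {κ : ℂ → ℂ → ℂ} (hκ : Measurable (Function.uncurry κ)) :
    Measurable fun ζ => S.contourIntegral (κ ζ) :=
  Finset.measurable_sum _ fun _ _ => (measurable_circleIntegral _ _ hκ).const_mul _

/-- The bound depends on `C` alone, hence is uniform when the integrand carries a parameter. -/
theorem exists_norm_contourIntegral_le (C : ℝ) : ∃ B : ℝ, ∀ f : ℂ → ℂ,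
    (∀ ζ ∈ S.support, ‖f ζ‖ ≤ C) → ‖S.contourIntegral f‖ ≤ B := by
  refine ⟨∑ i, 2 * Real.pi * S.radius i * C, fun f hf => (norm_sum_le _ _).trans
    (Finset.sum_le_sum fun i _ => ?_)⟩
  rw [norm_mul]
  have h1 : ‖(((S.orient i : ℤ)) : ℂ)‖ = 1 := by
    rcases Int.units_eq_one_or (S.orient i) with h | h <;> simp [h]
  rw [h1, one_mul]
  exact circleIntegral.norm_integral_le_of_norm_le_const (S.radius_pos i).le fun ζ hζ =>
    hf ζ (S.sphere_subset_support i hζ)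

/-- A function which is continuously differentiable on each of the disjoint circles is Lipschitz on
the contour. -/
theorem exists_lipschitzOnWith_support (hdisj : Pairwise fun i j => Disjoint
    (Metric.sphere (S.center i) (S.radius i)) (Metric.sphere (S.center j) (S.radius j)))
    {f : ℂ → ℂ} (hf : ∀ i, ∀ ζ ∈ Metric.sphere (S.center i) (S.radius i), ∃ g : ℂ → ℂ,
      ContDiffAt ℂ 1 g ζ ∧ Set.EqOn f g (Metric.sphere (S.center i) (S.radius i))) :
    ∃ K, LipschitzOnWith K f S.support := by
  refine LocallyLipschitzOn.exists_lipschitzOnWith_of_compact S.isCompact_support fun ζ hζ => ?_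
  obtain ⟨i, hi⟩ := Set.mem_iUnion.1 hζ
  obtain ⟨g, hg, hfg⟩ := hf i ζ hi
  obtain ⟨K, t, ht, hK⟩ := hg.exists_lipschitzOnWith
  -- Near `ζ` the contour consists only of the circle through `ζ`; compactness then upgrades the
  -- local Lipschitz property, also for pairs of points on different circles.
  have hmem : Metric.sphere (S.center i) (S.radius i) ∈ 𝓝[S.support] ζ := by
    filter_upwards [self_mem_nhdsWithin, mem_nhdsWithin_of_mem_nhds
      ((S.isClosed_otherCircles i).isOpen_compl.mem_nhds (S.disjoint_otherCircles hdisj hi))]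
      with w hw hw'
    obtain ⟨j, hj⟩ := Set.mem_iUnion.1 hw
    by_cases hji : j = i
    · exact hji ▸ hj
    · exact absurd (Set.mem_biUnion (show j ∈ {j | j ≠ i} from hji) hj) hw'
  refine ⟨K, t ∩ Metric.sphere (S.center i) (S.radius i),
    inter_mem (mem_nhdsWithin_of_mem_nhds ht) hmem, ?_⟩
  intro x hx y hy
  rw [hfg hx.2, hfg hy.2]
  exact hK hx.1 hy.1

end CircleSystem

/-! ### Cauchy integrals and moments on the outer circle -/

/-- The Cauchy integral `(2πi)⁻¹ ∮ (η - ζ)⁻¹ f(η) dη` over a circle. -/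
def cauchyInt (c : ℂ) (r : ℝ) (f : ℂ → ℂ) (ζ : ℂ) : ℂ :=
  (2 * Real.pi * Complex.I)⁻¹ * ∮ η in C(c, r), (η - ζ)⁻¹ * f η

/-- The moment `(2πi)⁻¹ ∮ η ^ l f(η) dη` over the circle of radius `R` about the origin. -/
def circleMoment (R : ℝ) (f : ℂ → ℂ) (l : ℤ) : ℂ :=
  (2 * Real.pi * Complex.I)⁻¹ * ∮ η in C(0, R), η ^ l * f η

theorem circleMoment_const {R : ℝ} (hR : 0 < R) (l : ℤ) (a : ℂ) :
    circleMoment R (fun _ => a) l = if l = -1 then a else 0 := by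
  have h : (∮ η in C(0, R), η ^ l * a) = (∮ η in C(0, R), (η - 0) ^ l) * a := by
    simpa using circleIntegral.integral_smul_const (fun η : ℂ => η ^ l) a 0 R
  rw [circleMoment, h]
  split_ifs with hl
  · subst hl
    simp only [zpow_neg_one]
    rw [circleIntegral.integral_sub_center_inv 0 hR.ne']
    field_simp
  · rw [circleIntegral.integral_sub_zpow_of_ne hl, zero_mul, mul_zero]

theorem continuousOn_zpow_sphere {R : ℝ} (hR : 0 < R) (e : ℤ) :
    ContinuousOn (fun η : ℂ => η ^ e) (Metric.sphere 0 R) := fun η hη =>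
  (continuousAt_zpow₀ η e (Or.inl (norm_pos_iff.1 (by
    rw [mem_sphere_zero_iff_norm] at hη; rw [hη]; exact hR)))).continuousWithinAt

theorem continuousOn_inv_sub {s : Set ℂ} {ζ : ℂ} (h : ζ ∉ s) :
    ContinuousOn (fun η => (η - ζ)⁻¹) s :=
  (continuousOn_id.sub continuousOn_const).inv₀ fun η hη => sub_ne_zero.2 fun hh =>
    h (by rw [← show η = ζ from hh]; exact hη)

/-- The Cauchy integral is the sum of a power series in the disc. Integrability of `f` suffices for
this, as is needed for `L²` densities. -/
theorem differentiableOn_cauchyInt {R : ℝ} (hR : 0 < R) {f : ℂ → ℂ} (hf : CircleIntegrable f 0 R) :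
    DifferentiableOn ℂ (cauchyInt 0 R f) (Metric.ball 0 R) := by
  lift R to NNReal using hR.le
  have := hasFPowerSeriesOn_cauchy_integral hf (by exact_mod_cast hR)
  have h2 := this.differentiableOn
  rw [Metric.eball_coe] at h2
  exact h2

theorem notMem_sphere_of_norm_lt {R : ℝ} {ζ : ℂ} (h : ‖ζ‖ < R) : ζ ∉ Metric.sphere (0 : ℂ) R := by
  rw [mem_sphere_zero_iff_norm]; exact h.ne

/-- Only the monomial of exponent `-1` has a nonzero integral, so the moment isolates a single
coefficient. -/
theorem circleMoment_eval {R : ℝ} (hR : 0 < R) {k : ℕ} {p : Polynomial ℂ}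
    (hp : p ∈ Polynomial.degreeLT ℂ k) (e l : ℤ) {j : ℕ} (hjk : j < k) (hj : l + e = -1 - j) :
    circleMoment R (fun η => η ^ e * p.eval η) l = p.coeff j := by
  have h1 : (∮ η in C(0, R), η ^ l * (η ^ e * p.eval η)) =
      ∮ η in C(0, R), ∑ i ∈ Finset.range k, η ^ (l + e + i) * p.coeff i := by
    refine circleIntegral.integral_congr hR.le fun η hη => ?_
    have hη0 : η ≠ 0 := norm_pos_iff.1 (by rw [mem_sphere_zero_iff_norm] at hη; rw [hη]; exact hR)
    simp only [eval_eq_sum_of_mem_degreeLT hp, Finset.mul_sum]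
    refine Finset.sum_congr rfl fun i _ => ?_
    rw [zpow_add₀ hη0, zpow_add₀ hη0, zpow_natCast]
    ring
  rw [circleMoment, h1, circleIntegral.integral_fun_sum, Finset.mul_sum]
  · rw [Finset.sum_eq_single j]
    · have := circleMoment_const hR (l + e + j) (p.coeff j)
      rw [if_pos (by rw [hj]; ring)] at this
      exact this
    · intro i _ hij
      have := circleMoment_const hR (l + e + i) (p.coeff i)
      rw [if_neg (by rw [hj]; intro hh; exact hij (by omega))] at this
      exact this
    · intro hh
      exact absurd (Finset.mem_range.2 hjk) hh
  · intro i _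
    exact ((continuousOn_zpow_sphere hR _).mul continuousOn_const).circleIntegrable hR.le

/-- Partial fractions, `(η - ζ)⁻¹ η⁻¹ = ζ⁻¹ ((η - ζ)⁻¹ - η⁻¹)`, give an induction on the power; at
the start the residues at `ζ` and `0` cancel. For `ζ = 0` the integrand is a pure power of exponent
at most `-2`. -/
theorem integral_inv_sub_mul_inv_pow {R : ℝ} {ζ : ℂ} (hζ : ‖ζ‖ < R) (n : ℕ) :
    (∮ η in C(0, R), (η - ζ)⁻¹ * (η ^ (n + 1))⁻¹) = 0 := by
  have hR : 0 < R := (norm_nonneg ζ).trans_lt hζ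
  have hne : ∀ η ∈ Metric.sphere (0 : ℂ) R, η ≠ 0 := fun η hη =>
    norm_pos_iff.1 (by rw [mem_sphere_zero_iff_norm] at hη; rw [hη]; exact hR)
  have hsub : ∀ η ∈ Metric.sphere (0 : ℂ) R, η - ζ ≠ 0 := fun η hη =>
    sub_ne_zero.2 fun hh => notMem_sphere_of_norm_lt hζ (hh ▸ hη)
  have hpow : ∀ n : ℕ, (∮ η in C(0, R), (η ^ (n + 1))⁻¹) = if n = 0 then
      2 * Real.pi * Complex.I else 0 := by
    intro n
    split_ifs with hn
    · subst hn
      simpa using circleIntegral.integral_sub_center_inv 0 hR.ne'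
    · have := circleIntegral.integral_sub_zpow_of_ne (n := -((n : ℤ) + 1)) (by omega) 0 0 R
      refine Eq.trans (circleIntegral.integral_congr hR.le fun η _ => ?_) this
      simp only [sub_zero]
      rw [zpow_neg]; norm_cast
  by_cases hζ0 : ζ = 0
  · subst hζ0
    have := hpow (n + 1)
    rw [if_neg (by omega)] at this
    refine Eq.trans (circleIntegral.integral_congr hR.le fun η hη => ?_) this
    have := hne η hη
    simp only [sub_zero]
    rw [pow_succ η (n + 1), mul_inv, mul_comm]
  have hstep : ∀ n : ℕ, (∮ η in C(0, R), (η - ζ)⁻¹ * (η ^ (n + 1))⁻¹) =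
      ζ⁻¹ * ((∮ η in C(0, R), (η - ζ)⁻¹ * (η ^ n)⁻¹) - ∮ η in C(0, R), (η ^ (n + 1))⁻¹) := by
    intro n
    rw [← circleIntegral.integral_sub, ← circleIntegral.integral_const_mul]
    · refine circleIntegral.integral_congr hR.le fun η hη => ?_
      have h1 := hne η hη
      have h2 := hsub η hη
      field_simp
      ring
    · exact ((continuousOn_inv_sub (notMem_sphere_of_norm_lt hζ)).mul
        ((continuousOn_id.pow n).inv₀ fun η hη => pow_ne_zero n (hne η hη))).circleIntegrable hR.le
    · exact ((continuousOn_id.pow (n + 1)).inv₀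
        fun η hη => pow_ne_zero (n + 1) (hne η hη)).circleIntegrable hR.le
  induction n with
  | zero =>
    rw [hstep, hpow, if_pos rfl]
    simp only [pow_zero, inv_one, mul_one]
    rw [circleIntegral.integral_sub_inv_of_mem_ball (mem_ball_zero_iff.2 hζ), sub_self, mul_zero]
  | succ n ih => rw [hstep, hpow, ih, if_neg (by omega), sub_self, mul_zero]

/-- The Cauchy integral of a function which extends holomorphically to the exterior with decay at
infinity vanishes inside. -/
theorem cauchyInt_inv_pow_mul_eval {R : ℝ} {ζ : ℂ} (hζ : ‖ζ‖ < R) {k : ℕ} {p : Polynomial ℂ}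
    (hp : p ∈ Polynomial.degreeLT ℂ k) :
    cauchyInt 0 R (fun η => η ^ (-k : ℤ) * p.eval η) ζ = 0 := by
  have hR : 0 < R := (norm_nonneg ζ).trans_lt hζ
  have h1 : (∮ η in C(0, R), (η - ζ)⁻¹ * (η ^ (-k : ℤ) * p.eval η)) =
      ∮ η in C(0, R), ∑ i ∈ Finset.range k,
        p.coeff i * ((η - ζ)⁻¹ * (η ^ (k - 1 - i + 1))⁻¹) := by
    refine circleIntegral.integral_congr hR.le fun η hη => ?_
    have hη0 : η ≠ 0 := norm_pos_iff.1 (by rw [mem_sphere_zero_iff_norm] at hη; rw [hη]; exact hR)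
    simp only [eval_eq_sum_of_mem_degreeLT hp, Finset.mul_sum]
    refine Finset.sum_congr rfl fun i hi => ?_
    have hik : k = i + (k - 1 - i + 1) := by have := Finset.mem_range.1 hi; omega
    have h2 : η ^ k = η ^ i * η ^ (k - 1 - i + 1) := by rw [← pow_add, ← hik]
    rw [zpow_neg, zpow_natCast, h2]
    field_simp
  rw [cauchyInt, h1, circleIntegral.integral_fun_sum, Finset.sum_eq_zero, mul_zero]
  · intro i _
    rw [circleIntegral.integral_const_mul, integral_inv_sub_mul_inv_pow hζ, mul_zero]
  · intro i _
    refine (continuousOn_const.mul ((continuousOn_inv_sub (notMem_sphere_of_norm_lt hζ)).mul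
      ((continuousOn_id.pow _).inv₀ fun η hη => pow_ne_zero _ ?_))).circleIntegrable hR.le
    exact norm_pos_iff.1 (by rw [mem_sphere_zero_iff_norm] at hη; rw [id, hη]; exact hR)

theorem cauchyInt_eval {R : ℝ} {ζ : ℂ} (hζ : ‖ζ‖ < R) (p : Polynomial ℂ) :
    cauchyInt 0 R (fun η => p.eval η) ζ = p.eval ζ := by
  have h := DiffContOnCl.circleIntegral_sub_inv_smul (f := fun η => p.eval η)
    p.differentiable.diffContOnCl (mem_ball_zero_iff.2 hζ)
  simp only [smul_eq_mul] at h
  rw [cauchyInt, h]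
  field_simp

/-- This geometric sum is what gives the kernel finite rank on the outer circle. Integer exponents
allow multiplication by `η ^ (-k)` later. -/
theorem zpow_mul_sub_geom {ζ η : ℂ} (hne : η ≠ ζ) (k : ℕ) :
    (η - ζ)⁻¹ * (η ^ k - ζ ^ k) = ∑ j ∈ Finset.range k, ζ ^ j * η ^ ((k : ℤ) - 1 - j) := by
  have h1 := Commute.geom_sum₂_mul (Commute.all ζ η) k
  have h2 : ∑ j ∈ Finset.range k, ζ ^ j * η ^ ((k : ℤ) - 1 - j) =
      ∑ j ∈ Finset.range k, ζ ^ j * η ^ (k - 1 - j) := by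
    refine Finset.sum_congr rfl fun j hj => ?_
    have := Finset.mem_range.1 hj
    rw [← zpow_natCast η (k - 1 - j)]
    congr 2
    omega
  have h3 : η - ζ ≠ 0 := sub_ne_zero.2 hne
  rw [h2, inv_mul_eq_iff_eq_mul₀ h3]
  linear_combination h1

/-- The polynomial with coefficients `a 0, …, a (k - 1)`. -/
def coeffPoly (k : ℕ) (a : ℕ → ℂ) : Polynomial ℂ :=
  ∑ j ∈ Finset.range k, Polynomial.C (a j) * Polynomial.X ^ j

theorem coeffPoly_mem (k : ℕ) (a : ℕ → ℂ) : coeffPoly k a ∈ Polynomial.degreeLT ℂ k := by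
  refine Submodule.sum_mem _ fun j hj => Polynomial.mem_degreeLT.2 ?_
  refine (Polynomial.degree_C_mul_X_pow_le _ _).trans_lt ?_
  exact_mod_cast Finset.mem_range.1 hj

theorem eval_coeffPoly (k : ℕ) (a : ℕ → ℂ) (z : ℂ) :
    (coeffPoly k a).eval z = ∑ j ∈ Finset.range k, a j * z ^ j := by
  simp [coeffPoly, Polynomial.eval_finsetSum]

theorem coeff_coeffPoly {k : ℕ} (a : ℕ → ℂ) {j : ℕ} (hj : j < k) :
    (coeffPoly k a).coeff j = a j := by
  simp [coeffPoly, hj]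

/-! ### The diagonal integral operators and their fixed points -/

namespace CircleSystem

variable {M : ℕ} {S : CircleSystem (M + 1)}

theorem measurable_outerPow (R : ℝ) (e : ℤ) : Measurable (outerPow R e) := by
  unfold outerPow
  refine Measurable.ite (measurableSet_eq_fun measurable_norm measurable_const) ?_ measurable_const
  rcases e with n | n
  · simpa using (measurable_id (α := ℂ)).pow_const n
  · simp only [zpow_negSucc]
    exact ((measurable_id (α := ℂ)).pow_const (n + 1)).inv

/-- The diagonal entries of the kernel of the integral equation. -/
def diagKernel (R : ℝ) (e : ℤ) (ζ η : ℂ) : ℂ :=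
  (η - ζ)⁻¹ * (outerPow R (-e) ζ * outerPow R e η - 1)

/-- The off-diagonal entry of the kernel of the integral equation. -/
def offKernel (R : ℝ) (k : ℕ) (b : ℂ → ℂ) (ζ η : ℂ) : ℂ :=
  (η - ζ)⁻¹ * (outerPow R k ζ * b η - b ζ * outerPow R k η)

/-- The integral operator with kernel `diagKernel`. -/
def diagOp (S : CircleSystem (M + 1)) (e : ℤ) (v : ℂ → ℂ) (ζ : ℂ) : ℂ :=
  (2 * Real.pi * Complex.I)⁻¹ * S.contourIntegral fun η => diagKernel (S.radius 0) e ζ η * v η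

/-- The sum of the Cauchy integrals over the inner circles, taken counterclockwise. -/
def holesInt (S : CircleSystem (M + 1)) (v : ℂ → ℂ) (ζ : ℂ) : ℂ :=
  ∑ i : Fin M, cauchyInt (S.center i.succ) (S.radius i.succ) v ζ

theorem diagOp_congr_ae {e : ℤ} {v w : ℂ → ℂ} (h : ∀ᵐ ζ ∂S.arcLength, v ζ = w ζ) (ζ : ℂ) :
    S.diagOp e v ζ = S.diagOp e w ζ := by
  rw [diagOp, diagOp, S.contourIntegral_congr]
  filter_upwards [h] with η hη
  rw [hη]

namespace IsNested

theorem contourIntegral_eq (h : S.IsNested) (f : ℂ → ℂ) : S.contourIntegral f =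
    (∮ z in C(0, S.radius 0), f z) -
      ∑ i : Fin M, ∮ z in C(S.center i.succ, S.radius i.succ), f z := by
  rw [contourIntegral, Fin.sum_univ_succ, h.center_zero, h.orient_zero]
  simp only [h.orient_succ]
  simp [sub_eq_add_neg]

theorem integral_outer_congr_ae (h : S.IsNested) {f g : ℂ → ℂ}
    (hfg : ∀ᵐ ζ ∂S.arcLength, ‖ζ‖ = S.radius 0 → f ζ = g ζ) :
    (∮ z in C(0, S.radius 0), f z) = ∮ z in C(0, S.radius 0), g z := by
  have := S.circleIntegral_congr_ae (i := 0) (f := f) (g := g) (by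
    filter_upwards [hfg] with ζ hζ h1
    rw [h.center_zero, mem_sphere_zero_iff_norm] at h1
    exact hζ h1)
  rwa [h.center_zero] at this

theorem norm_ne (h : S.IsNested) {i : Fin M} {ζ : ℂ}
    (hζ : ζ ∈ Metric.sphere (S.center i.succ) (S.radius i.succ)) : ‖ζ‖ ≠ S.radius 0 :=
  (h.norm_lt (Metric.sphere_subset_closedBall hζ)).ne

/-- For `ζ` and `η` both on inner circles the two factors are `1` and the kernel vanishes, so only
the outer circle contributes. -/
theorem diagOp_inner (h : S.IsNested) (e : ℤ) (v : ℂ → ℂ) {i : Fin M} {ζ : ℂ}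
    (hζ : ζ ∈ Metric.sphere (S.center i.succ) (S.radius i.succ)) :
    S.diagOp e v ζ = cauchyInt 0 (S.radius 0) (fun η => (η ^ e - 1) * v η) ζ := by
  rw [diagOp, h.contourIntegral_eq, cauchyInt, Finset.sum_eq_zero, sub_zero]
  · congr 1
    refine circleIntegral.integral_congr (S.radius_pos 0).le fun η hη => ?_
    simp only [diagKernel, outerPow_of_ne (h.norm_ne hζ),
      outerPow_of_eq (mem_sphere_zero_iff_norm.1 hη)]
    ring
  · intro j _
    rw [circleIntegral.integral_congr (S.radius_pos _).le (g := fun _ => 0)]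
    · simp [circleIntegral]
    · intro η hη
      simp [diagKernel, outerPow_of_ne (h.norm_ne hζ), outerPow_of_ne (h.norm_ne hη)]

/-- For `η` on an inner circle the kernel is `(ζ ^ (-e) - 1) / (η - ζ)`, so the inner circles enter
through Cauchy integrals only; the minus sign reflects their clockwise orientation. -/
theorem diagOp_outer (h : S.IsNested) (e : ℤ) (v : ℂ → ℂ) {ζ : ℂ} (hζ : ‖ζ‖ = S.radius 0) :
    S.diagOp e v ζ = (2 * Real.pi * Complex.I)⁻¹ * (∮ η in C(0, S.radius 0),
      (η - ζ)⁻¹ * (ζ ^ (-e) * η ^ e - 1) * v η) - (ζ ^ (-e) - 1) * S.holesInt v ζ := by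
  rw [diagOp, h.contourIntegral_eq, holesInt, mul_sub, Finset.mul_sum, Finset.mul_sum]
  congr 1
  · congr 1
    refine circleIntegral.integral_congr (S.radius_pos 0).le fun η hη => ?_
    simp only [diagKernel, outerPow_of_eq hζ, outerPow_of_eq (mem_sphere_zero_iff_norm.1 hη)]
  · refine Finset.sum_congr rfl fun i _ => ?_
    rw [cauchyInt, mul_left_comm, ← circleIntegral.integral_const_mul (ζ ^ (-e) - 1)]
    congr 1
    refine circleIntegral.integral_congr (S.radius_pos _).le fun η hη => ?_
    simp only [diagKernel, outerPow_of_eq hζ, outerPow_of_ne (h.norm_ne hη)]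
    ring

theorem circleIntegrable_outer (h : S.IsNested) {v : ℂ → ℂ} (hv : S.ContourIntegrable v) :
    CircleIntegrable v 0 (S.radius 0) := by
  have := hv 0
  rwa [h.center_zero] at this

theorem integral_zpow_mul_sum {R : ℝ} (hR : 0 < R) {v : ℂ → ℂ} (hv : CircleIntegrable v 0 R)
    (k : ℕ) (l : ℕ → ℤ) (ζ : ℂ) :
    (2 * Real.pi * Complex.I)⁻¹ * (∮ η in C(0, R), ∑ j ∈ Finset.range k, ζ ^ j * (η ^ l j * v η)) =
      (coeffPoly k fun j => circleMoment R v (l j)).eval ζ := by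
  rw [eval_coeffPoly, circleIntegral.integral_fun_sum, Finset.mul_sum]
  · refine Finset.sum_congr rfl fun j _ => ?_
    rw [circleIntegral.integral_const_mul, circleMoment]
    ring
  · intro j _
    refine CircleIntegrable.continuousOn_mul
      (hv.continuousOn_mul (f := v) (g := fun η => η ^ l j) ?_) continuousOn_const
    rw [abs_of_pos hR]
    exact continuousOn_zpow_sphere hR _

/-- The kernel is `ζ ^ (-k)` times the geometric sum of `ζ ^ j * η ^ (k - 1 - j)` over `j < k`. -/
theorem outer_integral_pos (h : S.IsNested) (k : ℕ) {v : ℂ → ℂ} (hv : S.ContourIntegrable v)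
    {ζ : ℂ} (hζ : ‖ζ‖ = S.radius 0) :
    (2 * Real.pi * Complex.I)⁻¹ * (∮ η in C(0, S.radius 0),
      (η - ζ)⁻¹ * (ζ ^ (-k : ℤ) * η ^ (k : ℤ) - 1) * v η) = ζ ^ (-k : ℤ) *
      (coeffPoly k fun j => circleMoment (S.radius 0) v (k - 1 - j)).eval ζ := by
  have hζ0 : ζ ≠ 0 := norm_pos_iff.1 (hζ ▸ S.radius_pos 0)
  rw [← integral_zpow_mul_sum (S.radius_pos 0) (h.circleIntegrable_outer hv), mul_left_comm,
    ← circleIntegral.integral_const_mul (ζ ^ (-k : ℤ))]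
  congr 1
  refine h.integral_outer_congr_ae ?_
  filter_upwards [S.ae_ne ζ] with η hne _
  have := zpow_mul_sub_geom hne k
  simp only [← mul_assoc, ← Finset.sum_mul]
  rw [← this, zpow_neg, zpow_natCast, zpow_natCast]
  field_simp

/-- The kernel is minus the sum of `ζ ^ j * η ^ (-1 - j)` over `j < k`: minus the kernel of the
projection to polynomials of degree less than `k`. This sign makes the second row uniquely solvable.
-/
theorem outer_integral_neg (h : S.IsNested) (k : ℕ) {v : ℂ → ℂ} (hv : S.ContourIntegrable v)
    (ζ : ℂ) :
    (2 * Real.pi * Complex.I)⁻¹ * (∮ η in C(0, S.radius 0),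
      (η - ζ)⁻¹ * (ζ ^ (-(-k : ℤ)) * η ^ (-k : ℤ) - 1) * v η) =
      - (coeffPoly k fun j => circleMoment (S.radius 0) v (-1 - j)).eval ζ := by
  rw [← integral_zpow_mul_sum (S.radius_pos 0) (h.circleIntegrable_outer hv), ← mul_neg,
    ← neg_one_mul (circleIntegral _ _ _), ← circleIntegral.integral_const_mul (-1)]
  congr 1
  refine h.integral_outer_congr_ae ?_
  filter_upwards [S.ae_ne ζ] with η hne hη
  have hη0 : η ≠ 0 := norm_pos_iff.1 (hη ▸ S.radius_pos 0)
  have h1 := zpow_mul_sub_geom hne k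
  have h2 : ∑ j ∈ Finset.range k, ζ ^ j * η ^ ((k : ℤ) - 1 - j) =
      η ^ k * ∑ j ∈ Finset.range k, ζ ^ j * η ^ (-1 - j : ℤ) := by
    rw [Finset.mul_sum]
    refine Finset.sum_congr rfl fun j _ => ?_
    rw [← zpow_natCast η k, mul_left_comm, ← zpow_add₀ hη0]
    congr 2
    ring
  rw [h2] at h1
  have h3 : ∑ j ∈ Finset.range k, ζ ^ j * η ^ (-1 - j : ℤ) =
      (η ^ k)⁻¹ * ((η - ζ)⁻¹ * (η ^ k - ζ ^ k)) := by
    rw [h1]; field_simp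
  simp only [← mul_assoc, ← Finset.sum_mul]
  rw [h3, neg_neg, zpow_neg, zpow_natCast, zpow_natCast]
  field_simp
  ring

/-- Cauchy's theorem in each hole: `ζ` lies outside it, and `g` is holomorphic on its closed disc.
-/
theorem holesInt_eq_zero (h : S.IsNested) {v g : ℂ → ℂ}
    (hg : DifferentiableOn ℂ g (Metric.ball 0 (S.radius 0)))
    (hvg : ∀ᵐ ζ ∂S.arcLength, ∀ i : Fin M,
      ζ ∈ Metric.sphere (S.center i.succ) (S.radius i.succ) → v ζ = g ζ)
    {ζ : ℂ} (hζ : S.radius 0 ≤ ‖ζ‖) : S.holesInt v ζ = 0 := by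
  refine Finset.sum_eq_zero fun i _ => ?_
  have h1 := S.circleIntegral_congr_ae (i := i.succ) (f := fun η => (η - ζ)⁻¹ * v η)
    (g := fun η => (η - ζ)⁻¹ * g η) (by
      filter_upwards [hvg] with η hη hi
      rw [hη i hi])
  have hζi : ζ ∉ Metric.closedBall (S.center i.succ) (S.radius i.succ) := fun hh => by
    linarith [h.norm_lt hh]
  have hne : ∀ η ∈ Metric.closedBall (S.center i.succ) (S.radius i.succ), η - ζ ≠ 0 :=
    fun η hη => sub_ne_zero.2 fun hh => hζi (hh ▸ hη)
  have hd : DifferentiableOn ℂ (fun η => (η - ζ)⁻¹ * g η)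
      (Metric.closedBall (S.center i.succ) (S.radius i.succ)) :=
    ((differentiableOn_id.sub_const ζ).inv hne).mul (hg.mono (h.subset_ball i))
  rw [cauchyInt, h1, DiffContOnCl.circleIntegral_eq_zero (S.radius_pos _).le
    (hd.mono (closure_ball _ (S.radius_pos _).ne').subset).diffContOnCl, mul_zero]

theorem cauchyInt_outer_congr_ae (h : S.IsNested) {f g : ℂ → ℂ}
    (hfg : ∀ᵐ ζ ∂S.arcLength, ‖ζ‖ = S.radius 0 → f ζ = g ζ) (ζ : ℂ) :
    cauchyInt 0 (S.radius 0) f ζ = cauchyInt 0 (S.radius 0) g ζ := by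
  rw [cauchyInt, cauchyInt, h.integral_outer_congr_ae]
  filter_upwards [hfg] with η hη hh
  rw [hη hh]

theorem circleMoment_congr_ae (h : S.IsNested) {f g : ℂ → ℂ}
    (hfg : ∀ᵐ ζ ∂S.arcLength, ‖ζ‖ = S.radius 0 → f ζ = g ζ) (l : ℤ) :
    circleMoment (S.radius 0) f l = circleMoment (S.radius 0) g l := by
  rw [circleMoment, circleMoment, h.integral_outer_congr_ae]
  filter_upwards [hfg] with η hη hh
  rw [hη hh]

/-- On the outer circle the density is `p - η ^ (-k) p`. Cauchy's formula reproduces the first term;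
the second extends to the exterior with decay and contributes nothing. -/
theorem _root_.CircleSystem.cauchyInt_outerPow_mul_eval {k : ℕ} {p : Polynomial ℂ}
    (hp : p ∈ Polynomial.degreeLT ℂ k) {ζ : ℂ} (hζ : ‖ζ‖ < S.radius 0) :
    cauchyInt 0 (S.radius 0)
      (fun η => (η ^ (k : ℤ) - 1) * (outerPow (S.radius 0) (-k) η * p.eval η)) ζ = p.eval ζ := by
  have hR := S.radius_pos 0
  have h1 := cauchyInt_eval hζ p
  have h2 := cauchyInt_inv_pow_mul_eval hζ hp
  have hinv := continuousOn_inv_sub (notMem_sphere_of_norm_lt hζ)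
  have hpc : ContinuousOn (fun η => p.eval η) (Metric.sphere 0 (S.radius 0)) :=
    p.continuous.continuousOn
  have h3 : (∮ η in C(0, S.radius 0), (η - ζ)⁻¹ *
      ((η ^ (k : ℤ) - 1) * (outerPow (S.radius 0) (-k) η * p.eval η))) =
      (∮ η in C(0, S.radius 0), (η - ζ)⁻¹ * p.eval η) -
        ∮ η in C(0, S.radius 0), (η - ζ)⁻¹ * (η ^ (-k : ℤ) * p.eval η) := by
    rw [← circleIntegral.integral_sub]
    · refine circleIntegral.integral_congr hR.le fun η hη => ?_
      have hη1 := mem_sphere_zero_iff_norm.1 hη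
      have hη0 : η ≠ 0 := norm_pos_iff.1 (hη1 ▸ hR)
      simp only [outerPow_of_eq hη1, zpow_neg, zpow_natCast]
      field_simp
    · exact (hinv.mul hpc).circleIntegrable hR.le
    · exact (hinv.mul ((continuousOn_zpow_sphere hR _).mul hpc)).circleIntegrable hR.le
  rw [cauchyInt] at h1 h2 ⊢
  rw [h3, mul_sub, h1, h2, sub_zero]

theorem differentiableOn_inner (h : S.IsNested) {v : ℂ → ℂ} (hv : S.ContourIntegrable v) (e : ℤ) :
    DifferentiableOn ℂ (cauchyInt 0 (S.radius 0) (fun η => (η ^ e - 1) * v η))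
      (Metric.ball 0 (S.radius 0)) := by
  refine differentiableOn_cauchyInt (S.radius_pos 0)
    ((h.circleIntegrable_outer hv).continuousOn_mul (g := fun η => η ^ e - 1) ?_)
  rw [abs_of_pos (S.radius_pos 0)]
  exact (continuousOn_zpow_sphere (S.radius_pos 0) e).sub continuousOn_const

/-- A fixed point of the diagonal operator has no contribution from the inner circles. -/
theorem holesInt_eq_zero_of_fixed (h : S.IsNested) {e : ℤ} {v : ℂ → ℂ}
    (hv : S.ContourIntegrable v) (hfix : ∀ᵐ ζ ∂S.arcLength, v ζ = S.diagOp e v ζ) {ζ : ℂ}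
    (hζ : ‖ζ‖ = S.radius 0) : S.holesInt v ζ = 0 := by
  refine h.holesInt_eq_zero (h.differentiableOn_inner hv e) ?_ hζ.ge
  filter_upwards [hfix] with η hη i hi
  rw [hη, h.diagOp_inner e v hi]

/-- Since the hole integrals of a fixed point vanish, its outer values have the form `ζ ^ (-k) p`;
the inner values are determined by these and equal `p`. -/
theorem eq_of_diagOp_pos (h : S.IsNested) {k : ℕ} {v : ℂ → ℂ} (hv : S.ContourIntegrable v)
    (hfix : ∀ᵐ ζ ∂S.arcLength, v ζ = S.diagOp k v ζ) :
    ∃ p ∈ Polynomial.degreeLT ℂ k,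
      ∀ᵐ ζ ∂S.arcLength, v ζ = outerPow (S.radius 0) (-k) ζ * p.eval ζ := by
  refine ⟨_, coeffPoly_mem k fun j => circleMoment (S.radius 0) v (k - 1 - j), ?_⟩
  have hout : ∀ᵐ ζ ∂S.arcLength, ‖ζ‖ = S.radius 0 → v ζ = outerPow (S.radius 0) (-k) ζ *
      (coeffPoly k fun j => circleMoment (S.radius 0) v (k - 1 - j)).eval ζ := by
    filter_upwards [hfix] with ζ hζ hn
    rw [hζ, h.diagOp_outer _ _ hn, h.holesInt_eq_zero_of_fixed hv hfix hn, mul_zero, sub_zero,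
      h.outer_integral_pos k hv hn, outerPow_of_eq hn]
  filter_upwards [hfix, hout, S.ae_mem_support] with ζ hζ hζo hs
  by_cases hn : ‖ζ‖ = S.radius 0
  · exact hζo hn
  · obtain ⟨i, hi⟩ := (h.mem_support.1 hs).resolve_left hn
    rw [hζ, h.diagOp_inner _ _ hi, outerPow_of_ne hn, one_mul, h.cauchyInt_outer_congr_ae
      (g := fun η => (η ^ (k : ℤ) - 1) * (outerPow (S.radius 0) (-k) η *
        (coeffPoly k fun j => circleMoment (S.radius 0) v (k - 1 - j)).eval η)),
      cauchyInt_outerPow_mul_eval (coeffPoly_mem k _)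
        (h.norm_lt (Metric.sphere_subset_closedBall hi))]
    filter_upwards [hout] with η hη hh
    rw [hη hh]

/-- The converse holds for every such `p`: the moments `k - 1 - j` of `η ^ (-k) p` are its own
coefficients, so no constraint arises. -/
theorem diagOp_pos_outerPow_mul_eval (h : S.IsNested) {k : ℕ} {p : Polynomial ℂ}
    (hp : p ∈ Polynomial.degreeLT ℂ k)
    (hint : S.ContourIntegrable fun η => outerPow (S.radius 0) (-k) η * p.eval η)
    {ζ : ℂ} (hs : ζ ∈ S.support) :
    S.diagOp k (fun η => outerPow (S.radius 0) (-k) η * p.eval η) ζ =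
      outerPow (S.radius 0) (-k) ζ * p.eval ζ := by
  rcases h.mem_support.1 hs with hn | ⟨i, hi⟩
  · rw [h.diagOp_outer _ _ hn, h.outer_integral_pos k hint hn,
      h.holesInt_eq_zero (g := fun η => p.eval η) p.differentiable.differentiableOn ?_ hn.ge,
      mul_zero, sub_zero, outerPow_of_eq hn]
    · congr 1
      rw [eval_coeffPoly, eval_eq_sum_of_mem_degreeLT hp]
      refine Finset.sum_congr rfl fun j hj => ?_
      rw [h.circleMoment_congr_ae (g := fun η => η ^ (-k : ℤ) * p.eval η),
        circleMoment_eval (S.radius_pos 0) hp _ _ (Finset.mem_range.1 hj) (by ring)]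
      exact Eventually.of_forall fun η hη => by simp only [outerPow_of_eq hη]
    · exact Eventually.of_forall fun η i hi => by rw [outerPow_of_ne (h.norm_ne hi), one_mul]
  · rw [h.diagOp_inner _ _ hi, cauchyInt_outerPow_mul_eval hp
      (h.norm_lt (Metric.sphere_subset_closedBall hi)), outerPow_of_ne (h.norm_ne hi), one_mul]

/-- On the outer circle a fixed point is minus the polynomial of its own moments. Taking moments
again gives `m j = -m j`, so the outer values vanish, and with them the inner ones. -/
theorem eq_zero_of_diagOp_neg (h : S.IsNested) {k : ℕ} {v : ℂ → ℂ} (hv : S.ContourIntegrable v)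
    (hfix : ∀ᵐ ζ ∂S.arcLength, v ζ = S.diagOp (-k) v ζ) : ∀ᵐ ζ ∂S.arcLength, v ζ = 0 := by
  set m : ℕ → ℂ := fun j => circleMoment (S.radius 0) v (-1 - j) with hm
  have hout : ∀ᵐ ζ ∂S.arcLength, ‖ζ‖ = S.radius 0 → v ζ = - (coeffPoly k m).eval ζ := by
    filter_upwards [hfix] with ζ hζ hn
    rw [hζ, h.diagOp_outer _ _ hn, h.holesInt_eq_zero_of_fixed hv hfix hn, mul_zero, sub_zero,
      h.outer_integral_neg k hv]
  have hm0 : ∀ j < k, m j = 0 := by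
    intro j hj
    have h1 : m j = - m j := by
      calc m j = circleMoment (S.radius 0) (fun η => η ^ (0 : ℤ) * (-coeffPoly k m).eval η)
            (-1 - j) := h.circleMoment_congr_ae (by
              filter_upwards [hout] with η hη hn
              rw [hη hn]; simp) _
        _ = - m j := by
          rw [circleMoment_eval (S.radius_pos 0) (Submodule.neg_mem _ (coeffPoly_mem k m)) _ _ hj
            (by ring), Polynomial.coeff_neg, coeff_coeffPoly m hj]
    exact self_eq_neg.1 h1
  have hp0 : ∀ ζ, (coeffPoly k m).eval ζ = 0 := fun ζ => by
    rw [eval_coeffPoly]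
    exact Finset.sum_eq_zero fun j hj => by rw [hm0 j (Finset.mem_range.1 hj), zero_mul]
  filter_upwards [hfix, hout, S.ae_mem_support] with ζ hζ hζo hs
  rcases h.mem_support.1 hs with hn | ⟨i, hi⟩
  · rw [hζo hn, hp0, neg_zero]
  · rw [hζ, h.diagOp_inner _ _ hi, h.cauchyInt_outer_congr_ae (g := fun _ => 0)]
    · simp [cauchyInt, circleIntegral]
    · filter_upwards [hout] with η hη hh
      rw [hη hh, hp0, neg_zero, mul_zero]

end IsNested

end CircleSystem

/-! ### Solvability of the second-row equation -/

namespace CircleSystem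

variable {M : ℕ} {S : CircleSystem (M + 1)}

theorem exists_bound_of_isCompact {s : Set ℂ} (hs : IsCompact s) {f : ℂ → ℂ}
    (hf : ContinuousOn f s) : ∃ C : ℝ, 0 ≤ C ∧ ∀ ζ ∈ s, ‖f ζ‖ ≤ C := by
  obtain ⟨C, hC⟩ := hs.exists_bound_of_continuousOn hf
  exact ⟨max C 0, le_max_right _ _, fun ζ hζ => (hC ζ hζ).trans (le_max_left _ _)⟩

namespace IsNested

theorem exists_pos_le_sub_norm (h : S.IsNested) :
    ∃ δ : ℝ, 0 < δ ∧ ∀ z ∈ S.holes, δ ≤ S.radius 0 - ‖z‖ := by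
  have hc : IsCompact S.holes := isCompact_iUnion fun _ => isCompact_closedBall _ _
  exact hc.exists_forall_le' (continuous_const.sub continuous_norm).continuousOn fun z hz => by
    have := h.holes_subset hz
    rw [mem_ball_zero_iff] at this
    exact sub_pos.2 this

theorem norm_inv_sub_le {δ : ℝ} (hδ0 : 0 < δ)
    (hδ : ∀ z ∈ S.holes, δ ≤ S.radius 0 - ‖z‖) {ζ η : ℂ} (hζ : ‖ζ‖ = S.radius 0) {i : Fin M}
    (hη : η ∈ Metric.sphere (S.center i.succ) (S.radius i.succ)) : ‖(η - ζ)⁻¹‖ ≤ δ⁻¹ := by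
  rw [norm_inv]
  refine inv_anti₀ hδ0 ((hδ η (Set.mem_iUnion.2 ⟨i, Metric.sphere_subset_closedBall hη⟩)).trans ?_)
  rw [← hζ, norm_sub_rev]
  exact norm_sub_norm_le ζ η

theorem continuousOn_inv_sub_inner (h : S.IsNested) {ζ : ℂ} (hζ : ‖ζ‖ = S.radius 0) (i : Fin M) :
    ContinuousOn (fun η => (η - ζ)⁻¹) (Metric.sphere (S.center i.succ) (S.radius i.succ)) :=
  continuousOn_inv_sub fun hh => h.norm_ne hh hζ

theorem measurable_cauchyInt {c : ℂ} {r : ℝ} {v : ℂ → ℂ} (hv : Measurable v) :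
    Measurable (cauchyInt c r v) := by
  refine (measurable_circleIntegral _ _ ?_).const_mul _
  exact (measurable_snd.sub measurable_fst).inv.mul (hv.comp measurable_snd)

theorem measurable_holesInt {v : ℂ → ℂ} (hv : Measurable v) : Measurable (S.holesInt v) :=
  Finset.measurable_sum _ fun _ _ => measurable_cauchyInt hv

theorem exists_holesInt_bound (h : S.IsNested) {v : ℂ → ℂ} {C : ℝ}
    (hC : ∀ ζ ∈ S.support, ‖v ζ‖ ≤ C) :
    ∃ B : ℝ, ∀ ζ, ‖ζ‖ = S.radius 0 → ‖S.holesInt v ζ‖ ≤ B := by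
  obtain ⟨δ, hδ0, hδ⟩ := h.exists_pos_le_sub_norm
  refine ⟨∑ i : Fin M, S.radius i.succ * (δ⁻¹ * C), fun ζ hζ => (norm_sum_le _ _).trans
    (Finset.sum_le_sum fun i _ => ?_)⟩
  rw [cauchyInt, ← smul_eq_mul]
  refine circleIntegral.norm_two_pi_i_inv_smul_integral_le_of_norm_le_const
    (S.radius_pos _).le fun η hη => ?_
  rw [norm_mul]
  exact mul_le_mul (norm_inv_sub_le hδ0 hδ hζ hη) (hC η (S.sphere_subset_support _ hη))
    (norm_nonneg _) (by positivity)

theorem holesInt_add (h : S.IsNested) {v w : ℂ → ℂ} (hv : S.ContourIntegrable v)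
    (hw : S.ContourIntegrable w) {ζ : ℂ} (hζ : ‖ζ‖ = S.radius 0) :
    S.holesInt (fun η => v η + w η) ζ = S.holesInt v ζ + S.holesInt w ζ := by
  rw [holesInt, holesInt, holesInt, ← Finset.sum_add_distrib]
  refine Finset.sum_congr rfl fun i _ => ?_
  have hint : ∀ {f : ℂ → ℂ}, S.ContourIntegrable f →
      CircleIntegrable (fun η => (η - ζ)⁻¹ * f η) (S.center i.succ) (S.radius i.succ) :=
    fun hf => (hf i.succ).continuousOn_mul (g := fun η => (η - ζ)⁻¹) (by
      rw [abs_of_pos (S.radius_pos _)]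
      exact h.continuousOn_inv_sub_inner hζ i)
  rw [cauchyInt, cauchyInt, cauchyInt, ← mul_add, ← circleIntegral.integral_add (hint hv) (hint hw)]
  simp only [mul_add]

open Classical in
/-- The inhomogeneous equation of the second row is solvable. -/
theorem exists_diagOp_neg (h : S.IsNested) (k : ℕ) {F : ℂ → ℂ} (hF : Measurable F) {C : ℝ}
    (hC0 : 0 ≤ C) (hC : ∀ ζ ∈ S.support, ‖F ζ‖ ≤ C) :
    ∃ v : ℂ → ℂ, Measurable v ∧ (∃ B, ∀ ζ ∈ S.support, ‖v ζ‖ ≤ B) ∧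
      ∀ ζ ∈ S.support, v ζ = S.diagOp (-k) v ζ + F ζ := by
  have hR := S.radius_pos 0
  have hFi := S.contourIntegrable_of_bound hF hC
  -- On the inner circles the solution differs from `F` by a function holomorphic in the disc, so
  -- both have the same hole integrals. `F₁` moves that known term to the right-hand side of the
  -- outer equation.
  set F₁ : ℂ → ℂ := fun ζ => F ζ - (ζ ^ k - 1) * S.holesInt F ζ with hF₁
  set m : ℕ → ℂ := fun j => circleMoment (S.radius 0) F₁ (-1 - j) with hm
  -- The outer equation reads `f + P f = F₁` with `P` the projection given by the moments. Applying
  -- `P` gives `2 P f = P F₁`, hence `f = F₁ - (1 / 2) P F₁`.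
  set f : ℂ → ℂ := fun ζ => F₁ ζ + (-(1 / 2 : ℂ) • coeffPoly k m).eval ζ with hf
  -- The bound on `f` is available on the outer circle only; truncation gives a function integrable
  -- along the whole contour without changing the Cauchy integral `A`.
  set f₀ : ℂ → ℂ := fun ζ => if ‖ζ‖ = S.radius 0 then f ζ else 0 with hf₀
  have hmR : MeasurableSet {ζ : ℂ | ‖ζ‖ = S.radius 0} :=
    measurableSet_eq_fun measurable_norm measurable_const
  have hF₁m : Measurable F₁ :=
    hF.sub (((measurable_id.pow_const k).sub_const 1).mul (measurable_holesInt hF))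
  have hfm : Measurable f := hF₁m.add (Polynomial.continuous _).measurable
  have hf₀m : Measurable f₀ := Measurable.ite hmR hfm measurable_const
  have hF₁b : ∃ B, ∀ ζ, ‖ζ‖ = S.radius 0 → ‖F₁ ζ‖ ≤ B := by
    obtain ⟨B, hB⟩ := h.exists_holesInt_bound hC
    refine ⟨C + (S.radius 0 ^ k + 1) * B, fun ζ hζ => (norm_sub_le _ _).trans
      (add_le_add (hC ζ (h.mem_support.2 (Or.inl hζ))) ?_)⟩
    rw [norm_mul]
    refine mul_le_mul ((norm_sub_le _ _).trans ?_) (hB ζ hζ) (norm_nonneg _) (by positivity)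
    rw [norm_pow, hζ, norm_one]
  have hfb : ∃ B, 0 ≤ B ∧ ∀ ζ, ‖ζ‖ = S.radius 0 → ‖f ζ‖ ≤ B := by
    obtain ⟨B, hB⟩ := hF₁b
    obtain ⟨B', h0, hB'⟩ := exists_bound_of_isCompact (isCompact_sphere (0 : ℂ) (S.radius 0))
      (f := fun ζ => (-(1 / 2 : ℂ) • coeffPoly k m).eval ζ) (Polynomial.continuous _).continuousOn
    exact ⟨max B 0 + B', by positivity, fun ζ hζ => (norm_add_le _ _).trans (add_le_add
      ((hB ζ hζ).trans (le_max_left _ _)) (hB' ζ (mem_sphere_zero_iff_norm.2 hζ)))⟩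
  obtain ⟨Bf, hBf0, hBf⟩ := hfb
  have hf₀i : S.ContourIntegrable f₀ := S.contourIntegrable_of_bound hf₀m (C := Bf)
    fun ζ _ => by
      simp only [hf₀]
      split_ifs with hn
      · exact hBf ζ hn
      · simpa using hBf0
  set A : ℂ → ℂ := cauchyInt 0 (S.radius 0) (fun η => (η ^ (-k : ℤ) - 1) * f₀ η) with hA
  have hAd : DifferentiableOn ℂ A (Metric.ball 0 (S.radius 0)) := h.differentiableOn_inner hf₀i _
  have hpowm : Measurable fun η : ℂ => η ^ (-k : ℤ) := by
    simp only [zpow_neg, zpow_natCast]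
    exact (measurable_id.pow_const k).inv
  have hAm : Measurable A := measurable_cauchyInt ((hpowm.sub_const 1).mul hf₀m)
  set v : ℂ → ℂ := fun ζ => if ‖ζ‖ = S.radius 0 then f ζ else A ζ + F ζ with hv
  have hvm : Measurable v := Measurable.ite hmR hfm (hAm.add hF)
  have hholes : IsCompact S.holes := isCompact_iUnion fun _ => isCompact_closedBall _ _
  obtain ⟨BA, hBA0, hBA⟩ := exists_bound_of_isCompact hholes (hAd.continuousOn.mono h.holes_subset)
  have hvb : ∀ ζ ∈ S.support, ‖v ζ‖ ≤ Bf + (BA + C) := by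
    intro ζ hζ
    simp only [hv]
    rcases h.mem_support.1 hζ with hn | ⟨i, hi⟩
    · rw [if_pos hn]
      exact (hBf ζ hn).trans (le_add_of_nonneg_right (by positivity))
    · rw [if_neg (h.norm_ne hi)]
      refine (norm_add_le _ _).trans ((add_le_add (hBA ζ (Set.mem_iUnion.2
        ⟨i, Metric.sphere_subset_closedBall hi⟩)) (hC ζ hζ)).trans ?_)
      exact le_add_of_nonneg_left hBf0
  have hvi := S.contourIntegrable_of_bound hvm hvb
  have hveq : ∀ ζ, ‖ζ‖ = S.radius 0 → v ζ = f ζ := fun ζ hn => if_pos hn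
  have hvne : ∀ ζ, ‖ζ‖ ≠ S.radius 0 → v ζ = A ζ + F ζ := fun ζ hn => if_neg hn
  have hholesv : ∀ ζ, ‖ζ‖ = S.radius 0 → S.holesInt v ζ = S.holesInt F ζ := by
    intro ζ hn
    set w : ℂ → ℂ := fun ζ => v ζ - F ζ with hw
    have hwi : S.ContourIntegrable w := fun i => (hvi i).sub (hFi i)
    have e1 : S.holesInt v ζ = S.holesInt (fun η => w η + F η) ζ := by simp [hw]
    rw [e1, h.holesInt_add hwi hFi hn, h.holesInt_eq_zero hAd ?_ hn.ge, zero_add]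
    refine Eventually.of_forall fun η i hi => ?_
    rw [hw]
    simp only [hvne η (h.norm_ne hi), add_sub_cancel_right]
  have hF₁i : CircleIntegrable F₁ 0 (S.radius 0) := by
    obtain ⟨B, hB⟩ := hF₁b
    have := S.contourIntegrable_of_bound (f := fun ζ => if ‖ζ‖ = S.radius 0 then F₁ ζ else 0)
      (C := max B 0) (Measurable.ite hmR hF₁m measurable_const) fun ζ _ => by
        split_ifs with hn
        · exact (hB ζ hn).trans (le_max_left _ _)
        · simp
    refine (circleIntegrable_congr ?_).1 (h.circleIntegrable_outer this)
    intro ζ hζ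
    rw [abs_of_pos hR] at hζ
    exact if_pos (mem_sphere_zero_iff_norm.1 hζ)
  have hmom : ∀ j < k, circleMoment (S.radius 0) v (-1 - j) = (1 / 2) * m j := by
    intro j hj
    have hq : -(1 / 2 : ℂ) • coeffPoly k m ∈ Polynomial.degreeLT ℂ k :=
      Submodule.smul_mem _ _ (coeffPoly_mem k m)
    have e1 := circleMoment_eval hR hq 0 (-1 - j) hj (by ring)
    simp only [zpow_zero, one_mul] at e1
    rw [Polynomial.coeff_smul, coeff_coeffPoly m hj, smul_eq_mul] at e1
    have e2 : circleMoment (S.radius 0) v (-1 - j) = circleMoment (S.radius 0) F₁ (-1 - j) +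
        circleMoment (S.radius 0) (fun η => (-(1 / 2 : ℂ) • coeffPoly k m).eval η) (-1 - j) := by
      rw [circleMoment, circleMoment, circleMoment, ← mul_add, ← circleIntegral.integral_add]
      · congr 1
        refine circleIntegral.integral_congr hR.le fun η hη => ?_
        simp only [hveq η (mem_sphere_zero_iff_norm.1 hη), hf, mul_add]
      · refine hF₁i.continuousOn_mul (g := fun η => η ^ (-1 - j : ℤ)) ?_
        rw [abs_of_pos hR]
        exact continuousOn_zpow_sphere hR _
      · exact ((continuousOn_zpow_sphere hR _).mul
          (Polynomial.continuous _).continuousOn).circleIntegrable hR.le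
    rw [e2, e1]
    simp only [hm]
    ring
  refine ⟨v, hvm, ⟨_, hvb⟩, fun ζ hζ => ?_⟩
  rcases h.mem_support.1 hζ with hn | ⟨i, hi⟩
  · rw [h.diagOp_outer _ _ hn, h.outer_integral_neg k hvi, hholesv ζ hn, hveq ζ hn, neg_neg,
      zpow_natCast]
    have e1 : (coeffPoly k fun j => circleMoment (S.radius 0) v (-1 - j)).eval ζ =
        (1 / 2) * (coeffPoly k m).eval ζ := by
      rw [eval_coeffPoly, eval_coeffPoly, Finset.mul_sum]
      refine Finset.sum_congr rfl fun j hj => ?_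
      rw [hmom j (Finset.mem_range.1 hj), mul_assoc]
    rw [e1]
    simp only [hf, hF₁, Polynomial.eval_smul, smul_eq_mul]
    ring
  · rw [h.diagOp_inner _ _ hi, hvne ζ (h.norm_ne hi), hA, h.cauchyInt_outer_congr_ae]
    refine Eventually.of_forall fun η hη => ?_
    simp only [hf₀, if_pos hη, hveq η hη]

end IsNested

end CircleSystem

/-! ### Kernel bounds and the nullity of the integral equation -/

namespace CircleSystem

variable {M : ℕ} {S : CircleSystem (M + 1)}

/-- Used with `x = η - ζ`. Since `0⁻¹ = 0`, the kernel bounds hold on the diagonal too. -/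
theorem norm_inv_mul_le {x y : ℂ} {C : ℝ} (hC : 0 ≤ C) (h : ‖y‖ ≤ C * ‖x‖) : ‖x⁻¹ * y‖ ≤ C := by
  rcases eq_or_ne x 0 with rfl | hx
  · simpa using hC
  · rw [norm_mul, norm_inv, inv_mul_le_iff₀ (norm_pos_iff.2 hx), mul_comm]
    exact h

theorem measurable_diagKernel (R : ℝ) (e : ℤ) :
    Measurable (Function.uncurry (diagKernel R e)) := by
  have h1 := measurable_outerPow R e
  have h2 := measurable_outerPow R (-e)
  exact (measurable_snd.sub measurable_fst).inv.mul
    (((h2.comp measurable_fst).mul (h1.comp measurable_snd)).sub_const 1)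

theorem measurable_offKernel (R : ℝ) (k : ℕ) {b : ℂ → ℂ} (hb : Measurable b) :
    Measurable (Function.uncurry (offKernel R k b)) := by
  have h1 := measurable_outerPow R k
  exact (measurable_snd.sub measurable_fst).inv.mul
    (((h1.comp measurable_fst).mul (hb.comp measurable_snd)).sub
      ((hb.comp measurable_fst).mul (h1.comp measurable_snd)))

namespace IsNested

theorem exists_lipschitz_outerPow (h : S.IsNested) (e : ℤ) :
    ∃ K, LipschitzOnWith K (outerPow (S.radius 0) e) S.support := by
  refine S.exists_lipschitzOnWith_support h.pairwise_disjoint_sphere fun i => ?_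
  refine Fin.cases (fun ζ hζ => ?_) (fun i ζ _ => ?_) i
  · rw [h.center_zero] at hζ ⊢
    have hn := mem_sphere_zero_iff_norm.1 hζ
    have hζ0 : ζ ≠ 0 := norm_pos_iff.1 (hn ▸ S.radius_pos 0)
    refine ⟨fun z => z ^ e, ?_, fun η hη => outerPow_of_eq (mem_sphere_zero_iff_norm.1 hη)⟩
    have hd : DifferentiableOn ℂ (fun z : ℂ => z ^ e) {0}ᶜ := fun z hz =>
      (differentiableAt_zpow.2 (Or.inl hz)).differentiableWithinAt
    exact (hd.analyticAt (isOpen_compl_singleton.mem_nhds hζ0)).contDiffAt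
  · exact ⟨fun _ => 1, contDiffAt_const, fun η hη => outerPow_of_ne (h.norm_ne hη)⟩

/-- The numerator vanishes at `η = ζ` and is Lipschitz in `η`, which cancels the singularity. -/
theorem exists_diagKernel_bound (h : S.IsNested) (e : ℤ) : ∃ C : ℝ, ∀ ζ ∈ S.support,
    ∀ η ∈ S.support, ‖diagKernel (S.radius 0) e ζ η‖ ≤ C := by
  obtain ⟨K, hK⟩ := h.exists_lipschitz_outerPow e
  obtain ⟨K', hK'⟩ := h.exists_lipschitz_outerPow (-e)
  obtain ⟨B, hB0, hB⟩ := exists_bound_of_isCompact S.isCompact_support hK'.continuousOn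
  refine ⟨B * K, fun ζ hζ η hη => norm_inv_mul_le (by positivity) ?_⟩
  have h1 : outerPow (S.radius 0) (-e) ζ * outerPow (S.radius 0) e η - 1 =
      outerPow (S.radius 0) (-e) ζ * (outerPow (S.radius 0) e η - outerPow (S.radius 0) e ζ) := by
    have := outerPow_ne_zero (S.radius_pos 0) (e := e) (ζ := ζ)
    rw [outerPow_neg]
    field_simp
  rw [h1, norm_mul, mul_assoc]
  have h2 := hK.dist_le_mul η hη ζ hζ
  rw [dist_eq_norm, dist_eq_norm] at h2
  exact mul_le_mul (hB ζ hζ) h2 (norm_nonneg _) hB0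

/-- The numerator is again zero on the diagonal; this bound is where the Lipschitz property of `b`
enters. -/
theorem exists_offKernel_bound (h : S.IsNested) (k : ℕ) {b : ℂ → ℂ} {K : NNReal}
    (hb : LipschitzOnWith K b S.support) : ∃ C : ℝ, ∀ ζ ∈ S.support,
    ∀ η ∈ S.support, ‖offKernel (S.radius 0) k b ζ η‖ ≤ C := by
  obtain ⟨K', hK'⟩ := h.exists_lipschitz_outerPow k
  obtain ⟨B, hB0, hB⟩ := exists_bound_of_isCompact S.isCompact_support hK'.continuousOn
  obtain ⟨B', hB0', hB'⟩ := exists_bound_of_isCompact S.isCompact_support hb.continuousOn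
  refine ⟨B * K + B' * K', fun ζ hζ η hη => norm_inv_mul_le (by positivity) ?_⟩
  have h1 : outerPow (S.radius 0) k ζ * b η - b ζ * outerPow (S.radius 0) k η =
      outerPow (S.radius 0) k ζ * (b η - b ζ) -
        b ζ * (outerPow (S.radius 0) k η - outerPow (S.radius 0) k ζ) := by ring
  rw [h1]
  refine (norm_sub_le _ _).trans ?_
  have h2 := hK'.dist_le_mul η hη ζ hζ
  have h3 := hb.dist_le_mul η hη ζ hζ
  rw [dist_eq_norm, dist_eq_norm] at h2 h3
  rw [norm_mul, norm_mul, add_mul, mul_assoc, mul_assoc]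
  exact add_le_add (mul_le_mul (hB ζ hζ) h3 (norm_nonneg _) hB0)
    (mul_le_mul (hB' ζ hζ) h2 (norm_nonneg _) hB0')

/-- Triangularity of the jump decouples the first row, and the reciprocal diagonal entries give the
exponents `k` and `-k`. -/
theorem _root_.CircleSystem.fredholmKernel_mul_apply {R : ℝ} (hR : 0 < R) {k : ℕ} {b : ℂ → ℂ}
    {G : ℂ → Matrix (Fin 2) (Fin 2) ℂ} {ζ η : ℂ} (hζ : G ζ = triJump R k b ζ)
    (hη : G η = triJump R k b η) (A : Matrix (Fin 2) (Fin 2) ℂ) (j : Fin 2) :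
    (fredholmKernel G ζ η * A) 0 j = diagKernel R k ζ η * A 0 j ∧
      (fredholmKernel G ζ η * A) 1 j = diagKernel R (-k) ζ η * A 1 j +
        offKernel R k b ζ η * A 0 j := by
  rw [fredholmKernel, hζ, triJump_inv hR, hη, triJump]
  simp only [Matrix.mul_apply, Fin.sum_univ_two, Matrix.smul_apply, Matrix.sub_apply,
    Matrix.of_apply, Matrix.cons_val_zero, Matrix.cons_val_one, smul_eq_mul,
    Matrix.cons_val', Matrix.cons_val_fin_one, diagKernel, offKernel, neg_neg,
    Matrix.one_apply_eq, Matrix.one_apply_ne zero_ne_one, Matrix.one_apply_ne one_ne_zero]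
  constructor <;> ring

/-- The homogeneous integral equation for a triangular jump matrix at a point, row by row. -/
theorem homogeneous_equation_iff (h : S.IsNested) {k : ℕ} {b : ℂ → ℂ}
    {G : ℂ → Matrix (Fin 2) (Fin 2) ℂ}
    (hG : ∀ ζ ∈ S.support, G ζ = triJump (S.radius 0) k b ζ) (hb : Measurable b) {K : NNReal}
    (hbL : LipschitzOnWith K b S.support) {A : ℂ → Matrix (Fin 2) (Fin 2) ℂ}
    (hA : ∀ i j, S.ContourIntegrable fun η => A η i j) {ζ : ℂ} (hζ : ζ ∈ S.support) :
    (∀ i j, S.ContourIntegrable (fun η => (fredholmKernel G ζ η * A η) i j) ∧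
      A ζ i j - (2 * Real.pi * Complex.I)⁻¹ *
        S.contourIntegral (fun η => (fredholmKernel G ζ η * A η) i j) = 0) ↔
      ∀ j, A ζ 0 j = S.diagOp k (fun η => A η 0 j) ζ ∧
        A ζ 1 j = S.diagOp (-k) (fun η => A η 1 j) ζ + (2 * Real.pi * Complex.I)⁻¹ *
          S.contourIntegral fun η => offKernel (S.radius 0) k b ζ η * A η 0 j := by
  obtain ⟨C₁, hC₁⟩ := h.exists_diagKernel_bound k
  obtain ⟨C₂, hC₂⟩ := h.exists_diagKernel_bound (-k)
  obtain ⟨C₃, hC₃⟩ := h.exists_offKernel_bound k hbL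
  have hmul := fun η hη => fredholmKernel_mul_apply (S.radius_pos 0) (hG ζ hζ) (hG η hη) (A η)
  have hint₁ := fun j => ContourIntegrable.bdd_mul S (hA 0 j)
    (measurable_diagKernel _ _).of_uncurry_left (hC₁ ζ hζ)
  have hint₂ := fun j => ContourIntegrable.bdd_mul S (hA 1 j)
    (measurable_diagKernel _ _).of_uncurry_left (hC₂ ζ hζ)
  have hint₃ := fun j => ContourIntegrable.bdd_mul S (hA 0 j)
    (measurable_offKernel _ _ hb).of_uncurry_left (hC₃ ζ hζ)
  have hadd : ∀ j, S.contourIntegral (fun η => (fredholmKernel G ζ η * A η) 1 j) =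
      S.contourIntegral (fun η => diagKernel (S.radius 0) (-k) ζ η * A η 1 j) +
        S.contourIntegral fun η => offKernel (S.radius 0) k b ζ η * A η 0 j := fun j => by
    rw [← S.contourIntegral_add (hint₂ j) (hint₃ j)]
    exact S.contourIntegral_congr_support fun η hη => (hmul η hη j).2
  have hzero : ∀ j, S.contourIntegral (fun η => (fredholmKernel G ζ η * A η) 0 j) =
      S.contourIntegral (fun η => diagKernel (S.radius 0) k ζ η * A η 0 j) := fun j =>
    S.contourIntegral_congr_support fun η hη => (hmul η hη j).1
  have hI : ∀ i j, S.ContourIntegrable (fun η => (fredholmKernel G ζ η * A η) i j) := by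
    refine Fin.forall_fin_two.2 ⟨fun j => ?_, fun j => ?_⟩
    · refine S.contourIntegrable_congr ?_ (hint₁ j)
      filter_upwards [S.ae_mem_support] with η hη using (hmul η hη j).1.symm
    · refine S.contourIntegrable_congr ?_ fun l => (hint₂ j l).add (hint₃ j l)
      filter_upwards [S.ae_mem_support] with η hη using (hmul η hη j).2.symm
  constructor
  · intro hh j
    have h0 := (hh 0 j).2
    have h1 := (hh 1 j).2
    rw [hzero, sub_eq_zero] at h0
    rw [hadd, mul_add, sub_eq_zero] at h1
    exact ⟨h0, h1⟩
  · intro hh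
    refine Fin.forall_fin_two.2 ⟨fun j => ⟨hI 0 j, ?_⟩, fun j => ⟨hI 1 j, ?_⟩⟩
    · rw [hzero, sub_eq_zero]
      exact (hh j).1
    · rw [hadd, mul_add, sub_eq_zero]
      exact (hh j).2

/-- The null space of the integral equation for a triangular jump matrix, row by row. -/
theorem mem_fredholmNullSpace_iff (h : S.IsNested) {k : ℕ} {b : ℂ → ℂ}
    {G : ℂ → Matrix (Fin 2) (Fin 2) ℂ}
    (hG : ∀ ζ ∈ S.support, G ζ = triJump (S.radius 0) k b ζ) (hb : Measurable b) {K : NNReal}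
    (hbL : LipschitzOnWith K b S.support) (u : S.L2Matrix) :
    u ∈ S.fredholmNullSpace G ↔ ∀ j,
      (∀ᵐ ζ ∂S.arcLength, u 0 j ζ = S.diagOp k (u 0 j) ζ) ∧
      (∀ᵐ ζ ∂S.arcLength, u 1 j ζ = S.diagOp (-k) (u 1 j) ζ + (2 * Real.pi * Complex.I)⁻¹ *
        S.contourIntegral fun η => offKernel (S.radius 0) k b ζ η * u 0 j η) := by
  simp only [← eventually_and]
  rw [← ae_all_iff]
  change (∀ᵐ ζ ∂S.arcLength, ∀ i j,
    S.ContourIntegrable (fun η => (fredholmKernel G ζ η * u.eval η) i j) ∧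
    u.eval ζ i j - (2 * Real.pi * Complex.I)⁻¹ *
      S.contourIntegral (fun η => (fredholmKernel G ζ η * u.eval η) i j) = 0) ↔ _
  refine eventually_congr ?_
  filter_upwards [S.ae_mem_support] with ζ hζ
  exact h.homogeneous_equation_iff hG hb hbL (A := u.eval)
    (fun i j => S.contourIntegrable_Lp (u i j)) hζ

theorem exists_outerPow_mul_eval_bound (h : S.IsNested) (e : ℤ) (p : Polynomial ℂ) :
    ∃ C : ℝ, 0 ≤ C ∧ ∀ ζ ∈ S.support, ‖outerPow (S.radius 0) e ζ * p.eval ζ‖ ≤ C := by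
  obtain ⟨K, hK⟩ := h.exists_lipschitz_outerPow e
  exact exists_bound_of_isCompact S.isCompact_support
    (hK.continuousOn.mul p.continuous.continuousOn)

theorem measurable_outerPow_mul_eval (R : ℝ) (e : ℤ) (p : Polynomial ℂ) :
    Measurable fun ζ => outerPow R e ζ * p.eval ζ :=
  (measurable_outerPow R e).mul p.continuous.measurable

theorem memLp_outerPow_mul_eval (h : S.IsNested) (e : ℤ) (p : Polynomial ℂ) :
    MemLp (fun ζ => outerPow (S.radius 0) e ζ * p.eval ζ) 2 S.arcLength := by
  obtain ⟨C, -, hC⟩ := h.exists_outerPow_mul_eval_bound e p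
  exact S.memLp_of_bound (measurable_outerPow_mul_eval _ _ _) hC

/-- The entry in the first row of a solution of the homogeneous integral equation. -/
def firstRowEntry (h : S.IsNested) (k : ℕ) : Polynomial.degreeLT ℂ k →ₗ[ℂ] Lp ℂ 2 S.arcLength where
  toFun p := (h.memLp_outerPow_mul_eval (-k) (p : Polynomial ℂ)).toLp _
  map_add' p q := by
    rw [← MemLp.toLp_add]
    congr 1
    funext ζ
    simp [mul_add]
  map_smul' c p := by
    rw [RingHom.id_apply, ← MemLp.toLp_const_smul]
    congr 1
    funext ζ
    simp [mul_left_comm]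

/-- The first rows of the solutions of the homogeneous integral equation. -/
def firstRow (h : S.IsNested) (k : ℕ) :
    (Fin 2 → Polynomial.degreeLT ℂ k) →ₗ[ℂ] (Fin 2 → Lp ℂ 2 S.arcLength) :=
  (h.firstRowEntry k).compLeft (Fin 2)

theorem firstRow_ae (h : S.IsNested) {k : ℕ} (p : Fin 2 → Polynomial.degreeLT ℂ k) (j : Fin 2) :
    ∀ᵐ ζ ∂S.arcLength, h.firstRow k p j ζ =
      outerPow (S.radius 0) (-k) ζ * (p j : Polynomial ℂ).eval ζ :=
  (h.memLp_outerPow_mul_eval (-k) (p j : Polynomial ℂ)).coeFn_toLp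

/-- The coefficients are moments over the outer circle, and moments see only the almost-everywhere
class. -/
theorem firstRow_injective (h : S.IsNested) (k : ℕ) : Function.Injective (h.firstRow k) := by
  rw [← LinearMap.ker_eq_bot, LinearMap.ker_eq_bot']
  intro p hp
  funext j
  ext1
  have h0 : ∀ᵐ ζ ∂S.arcLength, outerPow (S.radius 0) (-k) ζ * (p j : Polynomial ℂ).eval ζ = 0 := by
    filter_upwards [h.firstRow_ae p j, Lp.coeFn_zero ℂ 2 S.arcLength] with ζ h1 h2
    rw [← h1, hp, Pi.zero_apply, h2, Pi.zero_apply]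
  ext i
  by_cases hi : i < k
  · have h1 := circleMoment_eval (S.radius_pos 0) (p j).2 (-k) (k - 1 - i) hi (by ring)
    rw [h.circleMoment_congr_ae (g := fun _ => 0), circleMoment_const (S.radius_pos 0),
      ite_self] at h1
    · simpa using h1.symm
    · filter_upwards [h0] with ζ hζ hn
      rwa [outerPow_of_eq hn] at hζ
  · have := (p j).2
    rw [Polynomial.mem_degreeLT, Polynomial.degree_lt_iff_coeff_zero] at this
    simpa using this i (not_lt.1 hi)

/-- Restriction to the first row identifies the null space with the explicit first rows: the second
row is determined by uniqueness for exponent `-k`, and exists by solvability. -/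
theorem rank_fredholmNullSpace (h : S.IsNested) {k : ℕ} {b : ℂ → ℂ}
    {G : ℂ → Matrix (Fin 2) (Fin 2) ℂ}
    (hG : ∀ ζ ∈ S.support, G ζ = triJump (S.radius 0) k b ζ) (hb : Measurable b) {K : NNReal}
    (hbL : LipschitzOnWith K b S.support) :
    Module.rank ℂ (S.fredholmNullSpace G) = ((2 * k : ℕ) : Cardinal) := by
  have hmem := h.mem_fredholmNullSpace_iff hG hb hbL
  let L : S.fredholmNullSpace G →ₗ[ℂ] (Fin 2 → Lp ℂ 2 S.arcLength) :=
    { toFun := fun u => (u : S.L2Matrix) 0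
      map_add' := fun _ _ => rfl
      map_smul' := fun _ _ => rfl }
  have hLinj : Function.Injective L := by
    rw [← LinearMap.ker_eq_bot, LinearMap.ker_eq_bot']
    intro u hu
    have hu0 : ∀ j, (u : S.L2Matrix) 0 j = 0 := fun j => congrFun hu j
    refine Subtype.ext (Matrix.ext fun i j => ?_)
    fin_cases i
    · exact hu0 j
    · refine Lp.ext ?_
      have h1 := ((hmem u).1 u.2 j).2
      have h2 := h.eq_zero_of_diagOp_neg (k := k) (S.contourIntegrable_Lp ((u : S.L2Matrix) 1 j)) (by
        filter_upwards [h1] with ζ hζ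
        rw [hζ, S.contourIntegral_congr (g := fun _ => 0)]
        · simp [contourIntegral, circleIntegral]
        · filter_upwards [Lp.coeFn_zero ℂ 2 S.arcLength] with η hη
          rw [hu0, hη, Pi.zero_apply, mul_zero])
      filter_upwards [h2, Lp.coeFn_zero ℂ 2 S.arcLength] with ζ h3 h4
      exact h3.trans h4.symm
  have hrange : LinearMap.range L = LinearMap.range (h.firstRow k) := by
    ext w
    constructor
    · rintro ⟨u, rfl⟩
      have h1 : ∀ j, ∃ p : Polynomial.degreeLT ℂ k, ∀ᵐ ζ ∂S.arcLength, (u : S.L2Matrix) 0 j ζ =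
          outerPow (S.radius 0) (-k) ζ * (p : Polynomial ℂ).eval ζ := fun j => by
        obtain ⟨p, hp, hpe⟩ := h.eq_of_diagOp_pos (S.contourIntegrable_Lp ((u : S.L2Matrix) 0 j))
          ((hmem u).1 u.2 j).1
        exact ⟨⟨p, hp⟩, hpe⟩
      choose p hp using h1
      refine ⟨p, funext fun j => Lp.ext ?_⟩
      filter_upwards [h.firstRow_ae p j, hp j] with ζ h2 h3
      exact h2.trans h3.symm
    · rintro ⟨p, rfl⟩
      obtain ⟨C₃, hC₃⟩ := h.exists_offKernel_bound k hbL
      -- The source built from an explicit first row is measurable and bounded, because the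
      -- off-diagonal kernel and the row are bounded on the contour.
      have hsol : ∀ j, ∃ v : Lp ℂ 2 S.arcLength, ∀ᵐ ζ ∂S.arcLength,
          v ζ = S.diagOp (-k) v ζ + (2 * Real.pi * Complex.I)⁻¹ * S.contourIntegral
            fun η => offKernel (S.radius 0) k b ζ η * h.firstRow k p j η := by
        intro j
        obtain ⟨C, hC0, hC⟩ := h.exists_outerPow_mul_eval_bound (-k) (p j : Polynomial ℂ)
        obtain ⟨B, hB⟩ := S.exists_norm_contourIntegral_le (C₃ * C)
        have hFm : Measurable fun ζ => (2 * Real.pi * Complex.I : ℂ)⁻¹ * S.contourIntegral fun η =>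
            offKernel (S.radius 0) k b ζ η *
              (outerPow (S.radius 0) (-k) η * (p j : Polynomial ℂ).eval η) := by
          refine (S.measurable_contourIntegral ?_).const_mul _
          exact (measurable_offKernel _ k hb).mul
            ((measurable_outerPow_mul_eval (S.radius 0) (-k) (p j : Polynomial ℂ)).comp
              measurable_snd)
        obtain ⟨v, hvm, ⟨B', hvb⟩, hv⟩ := h.exists_diagOp_neg k hFm
          (C := ‖(2 * Real.pi * Complex.I : ℂ)⁻¹‖ * max B 0) (by positivity) fun ζ hζ => by
            rw [norm_mul]
            refine mul_le_mul_of_nonneg_left ((hB _ fun η hη => ?_).trans (le_max_left _ _))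
              (norm_nonneg _)
            rw [norm_mul]
            exact mul_le_mul (hC₃ ζ hζ η hη) (hC η hη) (norm_nonneg _)
              ((norm_nonneg _).trans (hC₃ ζ hζ η hη))
        have hvL := S.memLp_of_bound hvm hvb
        refine ⟨hvL.toLp v, ?_⟩
        filter_upwards [hvL.coeFn_toLp, S.ae_mem_support] with ζ h1 hζ
        rw [h1, diagOp_congr_ae hvL.coeFn_toLp, hv ζ hζ, S.contourIntegral_congr]
        filter_upwards [h.firstRow_ae p j] with η hη
        rw [hη]
      choose v hv using hsol
      refine ⟨⟨Matrix.of ![h.firstRow k p, v], (hmem _).2 fun j => ⟨?_, ?_⟩⟩, rfl⟩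
      · have hint : S.ContourIntegrable fun η =>
            outerPow (S.radius 0) (-k) η * (p j : Polynomial ℂ).eval η :=
          S.contourIntegrable_of_integrable
            ((h.memLp_outerPow_mul_eval (-k) (p j : Polynomial ℂ)).integrable one_le_two)
        filter_upwards [h.firstRow_ae p j, S.ae_mem_support] with ζ h1 hζ
        change h.firstRow k p j ζ = S.diagOp k (h.firstRow k p j) ζ
        rw [diagOp_congr_ae (h.firstRow_ae p j), h.diagOp_pos_outerPow_mul_eval (p j).2 hint hζ, h1]
      · exact hv j
  rw [← rank_range_of_injective L hLinj, hrange,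
    rank_range_of_injective _ (h.firstRow_injective k), rank_pi_degreeLT]

end IsNested

end CircleSystem

/-! ### The model problem and the discrete map as triangular jumps -/

namespace CircleSystem

theorem modelContour_isNested : IsNested (M := 0) modelContour where
  center_zero := rfl
  orient_zero := rfl
  orient_succ := fun i => i.elim0
  subset_ball := fun i => i.elim0
  pairwise_disjoint := fun i => i.elim0

theorem modelJump_eq (m : ℕ) (ζ : ℂ) (hζ : ζ ∈ modelContour.support) :
    modelJump m ζ = triJump 1 m Complex.exp ζ := by
  have hn : ‖ζ‖ = 1 := by
    rcases modelContour_isNested.mem_support.1 hζ with h | ⟨i, -⟩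
    · exact h
    · exact i.elim0
  rw [modelJump, triJump, outerPow_of_eq hn, outerPow_of_eq hn, zpow_neg, zpow_natCast]

theorem exists_lipschitz_exp : ∃ K, LipschitzOnWith K Complex.exp modelContour.support :=
  exists_lipschitzOnWith_support _ modelContour_isNested.pairwise_disjoint_sphere
    fun _ _ _ => ⟨Complex.exp, Complex.contDiff_exp.contDiffAt, fun _ _ => rfl⟩

theorem zaContour_isNested {r₁ r₂ R : ℝ} (h₁ : 0 < r₁) (h₂ : 0 < r₂) (hR : 0 < R)
    (hr₁ : r₁ < 1) (hr₂ : r₂ < 1) (hR₁ : 1 + r₁ < R) (hR₂ : 1 + r₂ < R) :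
    IsNested (M := 2) (zaContour r₁ r₂ R h₁ h₂ hR) where
  center_zero := rfl
  orient_zero := rfl
  orient_succ := fun i => by fin_cases i <;> rfl
  subset_ball := by
    refine Fin.forall_fin_two.2 ⟨?_, ?_⟩
    · exact Metric.closedBall_subset_ball' (x := (1 : ℂ)) (y := 0) (by
        rw [dist_zero_right, norm_one, add_comm]; exact hR₁)
    · exact Metric.closedBall_subset_ball' (x := (-1 : ℂ)) (y := 0) (by
        rw [dist_zero_right, norm_neg, norm_one, add_comm]; exact hR₂)
  pairwise_disjoint := by
    have hd : Disjoint (Metric.closedBall (1 : ℂ) r₁) (Metric.closedBall (-1) r₂) := by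
      refine Metric.closedBall_disjoint_closedBall ?_
      rw [dist_eq_norm, sub_neg_eq_add, one_add_one_eq_two, Complex.norm_ofNat]
      linarith
    intro i j hij
    fin_cases i <;> fin_cases j
    · exact absurd rfl hij
    · exact hd
    · exact hd.symm
    · exact absurd rfl hij

/-- The lower left entry of `zaG₁`. -/
def zaEntry (a : ℝ) (n m : ℕ) (ζ : ℂ) : ℂ :=
  Complex.exp (Complex.I * a * Real.pi / 4) *
    Complex.exp (-(a / 2) * Complex.log (ζ / Complex.I)) * ((ζ - 1) ^ m)⁻¹ * ((ζ + 1) ^ n)⁻¹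

open Classical in
/-- The lower left entry of `zaJump`. -/
def zaLower (a : ℝ) (n m : ℕ) (R : ℝ) (ζ : ℂ) : ℂ := if ‖ζ‖ = R then 0 else -zaEntry a n m ζ

theorem measurable_zaLower (a : ℝ) (n m : ℕ) (R : ℝ) : Measurable (zaLower a n m R) := by
  refine Measurable.ite (measurableSet_eq_fun measurable_norm measurable_const) measurable_const ?_
  have h1 : Measurable fun ζ : ℂ => Complex.log (ζ / Complex.I) :=
    Complex.measurable_log.comp (measurable_id.div_const _)
  exact ((((Complex.measurable_exp.comp (h1.const_mul _)).const_mul _).mul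
    ((measurable_id.sub_const 1).pow_const m).inv).mul
    ((measurable_id.add_const 1).pow_const n).inv).neg

/-- The condition on the real part keeps `ζ / I` off the negative real axis, the cut of the
principal logarithm. -/
theorem contDiffAt_zaEntry (a : ℝ) (n m : ℕ) {ζ : ℂ} (h0 : ζ.re ≠ 0) (h1 : ζ ≠ 1) (h2 : ζ ≠ -1) :
    ContDiffAt ℂ 1 (zaEntry a n m) ζ := by
  have hs : ζ / Complex.I ∈ Complex.slitPlane := by
    refine Complex.mem_slitPlane_iff.2 (Or.inr ?_)
    simpa [Complex.div_I] using h0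
  have hlog : ContDiffAt ℂ 1 (fun ζ : ℂ => Complex.log (ζ / Complex.I)) ζ :=
    (Complex.contDiffAt_log hs).comp ζ (contDiffAt_id.div_const _)
  exact ((contDiffAt_const.mul (contDiffAt_const.mul hlog).cexp).mul
    (((contDiffAt_id.sub contDiffAt_const).pow m).inv (pow_ne_zero m (sub_ne_zero.2 h1)))).mul
    (((contDiffAt_id.add contDiffAt_const).pow n).inv
      (pow_ne_zero n (by simpa [add_eq_zero_iff_eq_neg] using h2)))

theorem zaJump_eq {a : ℝ} {n m k : ℕ} (hk : n + m = k + k) (R : ℝ) (ζ : ℂ) :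
    zaJump a n m R ζ = triJump R k (zaLower a n m R) ζ := by
  by_cases hn : ‖ζ‖ = R
  · rw [zaJump, if_pos hn, triJump, zaLower, if_pos hn, zaG₂, outerPow_of_eq hn, outerPow_of_eq hn,
      zpow_neg, zpow_natCast, show (m + n) / 2 = k by omega]
  · rw [zaJump, if_neg hn, triJump, zaLower, if_neg hn, outerPow_of_ne hn, outerPow_of_ne hn]
    refine Matrix.inv_eq_right_inv ?_
    rw [zaG₁, Matrix.mul_fin_two, Matrix.one_fin_two]
    simp [zaEntry]

/-- Radii below one keep the small circles away from the imaginary axis, hence from the branch cut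
and from the opposite pole; the pole at the centre is avoided since the radius is positive. -/
theorem exists_lipschitz_zaLower (a : ℝ) (n m : ℕ) {r₁ r₂ R : ℝ} (h₁ : 0 < r₁) (h₂ : 0 < r₂)
    (hR : 0 < R) (hr₁ : r₁ < 1) (hr₂ : r₂ < 1) (hR₁ : 1 + r₁ < R) (hR₂ : 1 + r₂ < R) :
    ∃ K, LipschitzOnWith K (zaLower a n m R) (zaContour r₁ r₂ R h₁ h₂ hR).support := by
  have h := zaContour_isNested h₁ h₂ hR hr₁ hr₂ hR₁ hR₂
  have hre : ∀ (ζ c : ℂ) (r : ℝ), ζ ∈ Metric.sphere c r → |ζ.re - c.re| ≤ r := fun ζ c r hζ => by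
    rw [mem_sphere_iff_norm] at hζ
    simpa [hζ] using Complex.abs_re_le_norm (ζ - c)
  refine exists_lipschitzOnWith_support _ h.pairwise_disjoint_sphere fun i => ?_
  fin_cases i
  · intro ζ _
    exact ⟨fun _ => 0, contDiffAt_const, fun η hη => if_pos (mem_sphere_zero_iff_norm.1 hη)⟩
  · intro ζ hζ
    refine ⟨fun ζ => -zaEntry a n m ζ, (contDiffAt_zaEntry a n m ?_ ?_ ?_).neg,
      fun η hη => if_neg (h.norm_ne (i := 0) hη)⟩
    · have := abs_le.1 (hre ζ 1 r₁ hζ)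
      rw [Complex.one_re] at this
      linarith [this.1]
    · rintro rfl
      exact absurd (mem_sphere_iff_norm.1 hζ) (by simpa [zaContour] using h₁.ne)
    · rintro rfl
      have := abs_le.1 (hre (-1) 1 r₁ hζ)
      rw [Complex.one_re, Complex.neg_re, Complex.one_re] at this
      linarith [this.1]
  · intro ζ hζ
    refine ⟨fun ζ => -zaEntry a n m ζ, (contDiffAt_zaEntry a n m ?_ ?_ ?_).neg,
      fun η hη => if_neg (h.norm_ne (i := 1) hη)⟩
    · have := abs_le.1 (hre ζ (-1) r₂ hζ)
      rw [Complex.neg_re, Complex.one_re] at this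
      linarith [this.2]
    · rintro rfl
      have := abs_le.1 (hre 1 (-1) r₂ hζ)
      rw [Complex.one_re, Complex.neg_re, Complex.one_re] at this
      linarith [this.2]
    · rintro rfl
      exact absurd (mem_sphere_iff_norm.1 hζ) (by simpa [zaContour] using h₂.ne)

end CircleSystem

end


theorem lemma1 :
    (∀ (a : ℝ) (n m : ℕ) (r₁ r₂ R : ℝ) (h₁ : 0 < r₁) (h₂ : 0 < r₂) (hR : 0 < R),
      0 < a → a < 2 → Even (n + m) → r₁ < 1 → r₂ < 1 → 1 + r₁ < R → 1 + r₂ < R →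
        Module.rank ℂ ((zaContour r₁ r₂ R h₁ h₂ hR).associatedRHP (zaJump a n m R)) =
            ((n + m : ℕ) : Cardinal) ∧
        Module.rank ℂ ((zaContour r₁ r₂ R h₁ h₂ hR).fredholmNullSpace (zaJump a n m R)) =
            ((n + m : ℕ) : Cardinal)) ∧
    (∀ m : ℕ,
        Module.rank ℂ (modelContour.associatedRHP (modelJump m)) = ((2 * m : ℕ) : Cardinal) ∧
        Module.rank ℂ (modelContour.fredholmNullSpace (modelJump m)) =
            ((2 * m : ℕ) : Cardinal)) := by
  refine ⟨?_, fun m => ?_⟩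
  · intro a n m r₁ r₂ R h₁ h₂ hR _ _ hnm hr₁ hr₂ hR₁ hR₂
    obtain ⟨k, hk⟩ := hnm
    have h := CircleSystem.zaContour_isNested h₁ h₂ hR hr₁ hr₂ hR₁ hR₂
    obtain ⟨K, hK⟩ := CircleSystem.exists_lipschitz_zaLower a n m h₁ h₂ hR hr₁ hr₂ hR₁ hR₂
    rw [show n + m = 2 * k by omega]
    exact ⟨h.rank_associatedRHP fun ζ _ => CircleSystem.zaJump_eq hk R ζ,
      h.rank_fredholmNullSpace (fun ζ _ => CircleSystem.zaJump_eq hk R ζ)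
        (CircleSystem.measurable_zaLower a n m R) hK⟩
  · obtain ⟨K, hK⟩ := CircleSystem.exists_lipschitz_exp
    exact ⟨CircleSystem.modelContour_isNested.rank_associatedRHP (CircleSystem.modelJump_eq m),
      CircleSystem.modelContour_isNested.rank_fredholmNullSpace (CircleSystem.modelJump_eq m)
        Complex.measurable_exp hK⟩
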